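/- Conventions. Manifolds are Hausdorff, second countable, finite dimensional, and not assumed connected. $\mathsf G$ is a real-analytic Lie group and $\mathsf H\subset\mathsf G$ is a (not necessarily closed) Lie subgroup, i.e. the image of an injective $\mathcal C^\omega$-immersion of a (second countable) real-analytic Lie group which is a group homomorphism, with the manifold topology carried over from that group. Neighborhoods of the unit in $\mathsf G$ are open and symmetric ($U=U^{-1}$). A set $S\ni e$ in $\mathsf G$ is a *sub-local group with associated neighborhood* $V$ if $V\supset S$ is open and, for $a,b\in S$, $a^{-1}\in V$ implies $a^{-1}\in S$ and $ab\in V$ implies $ab\in S$. An *admissible triple* for $\mathsf H$ in $\mathsf G$ is $(U_{\mathsf H},U,V)$ with $U_{\mathsf H}\subset\mathsf H$ a neighborhood of the unit in the manifold topology of $\mathsf H$ and $U,V\subset\mathsf G$ neighborhoods of the unit, such that $U_{\mathsf H}$ is a sub-local group of $\mathsf G$ with associated neighborhood $V$, $U_{\mathsf H}$ is closed in $V$, and $U^6\subset V$. A *local Lie group of $\mathcal C^k$-transformations* on a pointed manifold $(M,p)$ is a tuple $(\mathsf G,\mathcal U,\Omega,\mathcal W,\Theta)$ with $\mathsf G$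 a Lie group, $\mathcal U\subset \mathsf G$ a neighborhood of the unit $e$, $\Omega\subset M$ an open neighborhood of $p$, $\mathcal W\subset\mathcal U\times\Omega$ open with $\mathcal U\times\{p\}\subset\mathcal W$ and $\{e\}\times\Omega\subset\mathcal W$, and $\Theta:\mathcal W\to\Omega$ a $\mathcal C^k$ map such that $\Theta(e,x)=x$ for $x\in\Omega$, and $\Theta(a,\Theta(b,x))=\Theta(ab,x)$ for $a,b\in\mathcal U$ and $x\in\Omega$ whenever $(b,x),(ab,x),(a,\Theta(b,x))\in\mathcal W$. It is *transitive* if the set of all defined values $\Theta(a_1,\Theta(a_2,\dots\Theta(a_N,p)))$, with $N\ge1$ and $a_i\in\mathcal U$, contains a neighborhood of $p$. Two such tuples $(\mathsf G_i,\mathcal U_i,\Omega_i,\mathcal W_i,\Theta_i)$ on $(M_i,p_i)$, $i=1,2$, are *locally $\mathcal C^k$-equivalent* if there are a neighborhood $N\subset\mathcal U_1$ of the unit, a local isomorphism $\varphi$ from $\mathsf G_1$ to $\mathsf G_2$ defined on $N$ with $\varphi(N)\subset\mathcal U_2$ (a continuous local homomorphism with a continuous local homomorphism as inverse near the units), open neighborhoods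 $O'\subset O\subset\Omega_1$ of $p_1$, and an open $\mathcal C^k$-embedding $f:O\to\Omega_2$ with $f(p_1)=p_2$, such that $N\times O'\subset\mathcal W_1$, $\Theta_1(N\times O')\subset O$, $\varphi(N)\times f(O')\subset\mathcal W_2$, and $f(\Theta_1(a,x))=\Theta_2(\varphi(a),f(x))$ on $N\times O'$. **Proposition.** Let $\mathsf G$ be a Lie group and $\mathsf H\subset\mathsf G$ a Lie subgroup. (a) There is an admissible triple $(U_{\mathsf H},U,V)$ for $\mathsf H$ in $\mathsf G$; it can be chosen with $U$ connected. (b) For every admissible triple $(U_{\mathsf H},U,V)$, the relation $a\sim b\iff a^{-1}b\in U_{\mathsf H}$ is an equivalence relation on $U$, and the class of $a\in U$ is $(aU_{\mathsf H})\cap U$. (c) For every admissible triple $(U_{\mathsf H},U,V)$, the quotient space $U/{\sim}$ is a topological manifold (connected if $U$ is), and it admits a real-analytic structure, compatible with the quotient topology, such that - the projection $\pi:U\to U/{\sim}$ is a $\mathcal C^\omega$-submersion; - with $\mathcal W=\{(a,[b]): a,b\in U,\ ab\in U\}$ the map $\Theta(a,[b])=[ab]$ (for $a,b,ab\in U$)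 is well defined on $\mathcal W$, and $(\mathsf G,U,U/{\sim},\mathcal W,\Theta)$ is a local Lie group of $\mathcal C^\omega$-transformations acting transitively on $(U/{\sim},[e])$. Any two real-analytic structures with these properties are $\mathcal C^\omega$-diffeomorphic, in fact by the identity map of $U/{\sim}$. (d) For any two admissible triples for $\mathsf H$ in $\mathsf G$, the two local Lie groups of $\mathcal C^\omega$-transformations in (c) are locally $\mathcal C^\omega$-equivalent. -/

import Mathlib

open Set Topology Manifold
open scoped ContDiff Pointwise

/-- `ι : H →* G` exhibits the Lie group `H` as a (not necessarily closed) Lie subgroup of the Lie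
group `G`: it is an injective analytic immersion. The Lie subgroup itself is `Set.range ι`, with
the manifold topology transported from `H`. -/
structure IsLieSubgroup {E F G H : Type*}
    [NormedAddCommGroup E] [NormedSpace ℝ E] [NormedAddCommGroup F] [NormedSpace ℝ F]
    [Group G] [TopologicalSpace G] [ChartedSpace E G]
    [Group H] [TopologicalSpace H] [ChartedSpace F H] (ι : H →* G) : Prop where
  injective : Function.Injective ι
  contMDiff : ContMDiff 𝓘(ℝ, F) 𝓘(ℝ, E) ω ι
  immersion : ∀ h : H, Function.Injective (mfderiv 𝓘(ℝ, F) 𝓘(ℝ, E) ι h)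

/-- `S` is a sub-local group of the group `G` with associated neighborhood `V`. -/
structure IsSubLocalGroup {G : Type*} [Group G] [TopologicalSpace G] (S V : Set G) : Prop where
  one_mem : (1 : G) ∈ S
  isOpen : IsOpen V
  subset : S ⊆ V
  inv_mem : ∀ a ∈ S, a⁻¹ ∈ V → a⁻¹ ∈ S
  mul_mem : ∀ a ∈ S, ∀ b ∈ S, a * b ∈ V → a * b ∈ S

/-- `(UH, U, V)` is an admissible triple for the Lie subgroup `ι : H →* G`. Neighborhoods of the
unit of `G` are open and symmetric. -/
structure IsAdmissibleTriple {G H : Type*} [Group G] [TopologicalSpace G]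
    [Group H] [TopologicalSpace H] (ι : H →* G)
    (UH : Set G) (U V : TopologicalSpace.Opens G) : Prop where
  subset_range : UH ⊆ range ι
  /-- `UH` is a neighborhood of the unit for the manifold topology of the Lie subgroup -/
  preimage_mem_nhds : ι ⁻¹' UH ∈ 𝓝 (1 : H)
  one_mem_U : (1 : G) ∈ U
  inv_U : (U : Set G)⁻¹ = U
  one_mem_V : (1 : G) ∈ V
  inv_V : (V : Set G)⁻¹ = V
  isSubLocalGroup : IsSubLocalGroup UH (V : Set G)
  /-- `UH` is closed in `V` -/
  isClosed : IsClosed ((↑) ⁻¹' UH : Set V)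
  /-- products of six elements of `U` lie in `V` -/
  pow_subset : (U : Set G) ^ 6 ⊆ V

/-- The relation `a ~ b ↔ a⁻¹ * b ∈ UH` on `U`. -/
def localRel {G : Type*} [Group G] [TopologicalSpace G] (UH : Set G)
    (U : TopologicalSpace.Opens G) (a b : U) : Prop :=
  (a : G)⁻¹ * (b : G) ∈ UH

/-- The local factor space `U / ~`, with the quotient topology. -/
def LocalFactorSpace {G : Type*} [Group G] [TopologicalSpace G] (UH : Set G)
    (U : TopologicalSpace.Opens G) : Type _ :=
  Quot (localRel UH U)

instance {G : Type*} [Group G] [TopologicalSpace G] (UH : Set G)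
    (U : TopologicalSpace.Opens G) : TopologicalSpace (LocalFactorSpace UH U) :=
  inferInstanceAs (TopologicalSpace (Quot (localRel UH U)))

/-- The canonical projection `U → U / ~`. -/
def localProj {G : Type*} [Group G] [TopologicalSpace G] (UH : Set G)
    (U : TopologicalSpace.Opens G) (a : U) : LocalFactorSpace UH U :=
  Quot.mk (localRel UH U) a

/-- The data of a tuple `(G, 𝒰, Ω, 𝒲, Θ)` on a pointed space `(M, p)`. The map `Θ` is a partial
map: only its values on `W` are meaningful. -/
structure LocalTransformationTuple (G M : Type*) where
  U : Set G
  p : M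
  Ω : Set M
  W : Set (G × M)
  Θ : G × M → M

/-- The tuple is a local topological group of `C^k`-transformations on `(M, p)`. -/
structure LocalTransformationTuple.IsLocalGroup {G M B : Type*}
    [Group G] [TopologicalSpace G] [NormedAddCommGroup B] [NormedSpace ℝ B]
    [TopologicalSpace M] [ChartedSpace B M] (k : WithTop ℕ∞)
    (T : LocalTransformationTuple G M) : Prop where
  isOpen_U : IsOpen T.U
  one_mem : (1 : G) ∈ T.U
  inv_U : T.U⁻¹ = T.U
  isOpen_Ω : IsOpen T.Ω
  p_mem : T.p ∈ T.Ω
  isOpen_W : IsOpen T.W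
  W_subset : T.W ⊆ T.U ×ˢ T.Ω
  U_prod_p_subset : T.U ×ˢ {T.p} ⊆ T.W
  one_prod_Ω_subset : {(1 : G)} ×ˢ T.Ω ⊆ T.W
  mapsTo : MapsTo T.Θ T.W T.Ω
  continuousOn : ContinuousOn T.Θ T.W
  mul_act : ∀ a ∈ T.U, ∀ b ∈ T.U, ∀ x ∈ T.Ω,
    (b, x) ∈ T.W → (a * b, x) ∈ T.W → (a, T.Θ (b, x)) ∈ T.W →
      T.Θ (a, T.Θ (b, x)) = T.Θ (a * b, x)
  contMDiffOn : ∀ a ∈ T.U,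
    ContMDiffOn 𝓘(ℝ, B) 𝓘(ℝ, B) k (fun x => T.Θ (a, x)) {x | (a, x) ∈ T.W}
  one_act : ∀ x ∈ T.Ω, T.Θ (1, x) = x

/-- The tuple is a local Lie group of `C^k`-transformations on `(M, p)` (it is meant for a Lie
group `G`): in addition, `Θ` is jointly of class `C^k` on `W`. -/
structure LocalTransformationTuple.IsLocalLieGroup {G M A B : Type*}
    [NormedAddCommGroup A] [NormedSpace ℝ A] [NormedAddCommGroup B] [NormedSpace ℝ B]
    [Group G] [TopologicalSpace G] [ChartedSpace A G]
    [TopologicalSpace M] [ChartedSpace B M] (k : WithTop ℕ∞)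
    (T : LocalTransformationTuple G M) : Prop extends T.IsLocalGroup (B := B) k where
  contMDiffOn_W : ContMDiffOn (𝓘(ℝ, A).prod 𝓘(ℝ, B)) 𝓘(ℝ, B) k T.Θ T.W

/-- The orbit of the tuple through `p`: the points `Θ(a₁) (⋯ (Θ(a_N) p))`, with `N ≥ 1` and `aᵢ` in
`U`, such that all the successive values are defined. -/
inductive LocalTransformationTuple.Orbit {G M : Type*} (T : LocalTransformationTuple G M) :
    M → Prop
  | base (a : G) (ha : a ∈ T.U) : T.Orbit (T.Θ (a, T.p))
  | step (a : G) (x : M) (ha : a ∈ T.U) (hx : T.Orbit x) (hW : (a, x) ∈ T.W) :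
      T.Orbit (T.Θ (a, x))

/-- Transitivity: the orbit through `p` contains a neighborhood of `p`. -/
def LocalTransformationTuple.IsTransitive {G M : Type*} [TopologicalSpace M]
    (T : LocalTransformationTuple G M) : Prop :=
  {x | T.Orbit x} ∈ 𝓝 T.p

/-- `(N, φ)` is a local homomorphism from `G₁` to `G₂`; only the values of `φ` on `N` matter. -/
structure IsLocalGroupHom {G₁ G₂ : Type*} [Group G₁] [TopologicalSpace G₁]
    [Group G₂] [TopologicalSpace G₂] (N : Set G₁) (φ : G₁ → G₂) : Prop where
  isOpen : IsOpen N
  one_mem : (1 : G₁) ∈ N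
  inv : N⁻¹ = N
  continuousOn : ContinuousOn φ N
  map_one : φ 1 = 1
  map_inv : ∀ a ∈ N, φ a⁻¹ = (φ a)⁻¹
  map_mul : ∀ a ∈ N, ∀ b ∈ N, a * b ∈ N → φ (a * b) = φ a * φ b

/-- A local isomorphism: a local homomorphism with a local inverse, the two compositions being
the identity near the units. -/
def IsLocalIso {G₁ G₂ : Type*} [Group G₁] [TopologicalSpace G₁]
    [Group G₂] [TopologicalSpace G₂] (N : Set G₁) (φ : G₁ → G₂) : Prop :=
  IsLocalGroupHom N φ ∧ ∃ (N' : Set G₂) (ψ : G₂ → G₁), IsLocalGroupHom N' ψ ∧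
    (∀ᶠ a in 𝓝 (1 : G₁), ψ (φ a) = a) ∧ (∀ᶠ b in 𝓝 (1 : G₂), φ (ψ b) = b)

/-- `f` restricts to an open `C^k`-embedding of the open set `O`: a `C^k`-diffeomorphism from `O`
onto an open set. -/
def IsOpenCkEmbeddingOn {M₁ M₂ B₁ B₂ : Type*}
    [NormedAddCommGroup B₁] [NormedSpace ℝ B₁] [NormedAddCommGroup B₂] [NormedSpace ℝ B₂]
    [TopologicalSpace M₁] [ChartedSpace B₁ M₁] [TopologicalSpace M₂] [ChartedSpace B₂ M₂]
    (k : WithTop ℕ∞) (f : M₁ → M₂) (O : Set M₁) : Prop :=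
  IsOpen O ∧ IsOpen (f '' O) ∧ ContMDiffOn 𝓘(ℝ, B₁) 𝓘(ℝ, B₂) k f O ∧
    ∃ g : M₂ → M₁, ContMDiffOn 𝓘(ℝ, B₂) 𝓘(ℝ, B₁) k g (f '' O) ∧ ∀ x ∈ O, g (f x) = x

/-- Local `C^k`-equivalence of two local groups of `C^k`-transformations. -/
def LocallyEquivalent {G₁ G₂ M₁ M₂ B₁ B₂ : Type*}
    [Group G₁] [TopologicalSpace G₁] [Group G₂] [TopologicalSpace G₂]
    [NormedAddCommGroup B₁] [NormedSpace ℝ B₁] [NormedAddCommGroup B₂] [NormedSpace ℝ B₂]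
    [TopologicalSpace M₁] [ChartedSpace B₁ M₁] [TopologicalSpace M₂] [ChartedSpace B₂ M₂]
    (k : WithTop ℕ∞) (T₁ : LocalTransformationTuple G₁ M₁)
    (T₂ : LocalTransformationTuple G₂ M₂) : Prop :=
  ∃ (N : Set G₁) (φ : G₁ → G₂) (O' O : Set M₁) (f : M₁ → M₂),
    N ⊆ T₁.U ∧ IsLocalIso N φ ∧ MapsTo φ N T₂.U ∧
    IsOpen O' ∧ T₁.p ∈ O' ∧ O' ⊆ O ∧ O ⊆ T₁.Ω ∧
    IsOpenCkEmbeddingOn (B₁ := B₁) (B₂ := B₂) k f O ∧ MapsTo f O T₂.Ω ∧ f T₁.p = T₂.p ∧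
    N ×ˢ O' ⊆ T₁.W ∧ MapsTo T₁.Θ (N ×ˢ O') O ∧ (φ '' N) ×ˢ (f '' O') ⊆ T₂.W ∧
    ∀ a ∈ N, ∀ x ∈ O', f (T₁.Θ (a, x)) = T₂.Θ (φ a, f x)

open Classical in
/-- The tuple `(G, U, U/~, W, Θ)` on the local factor space, with base point the class of `1`,
`W = {(a, [b]) : a, b, a * b ∈ U}` and `Θ(a, [b]) = [a * b]`. The representative `b` with
`a * b ∈ U` is picked by choice, and `Θ` gets a dummy value outside `W`. -/
noncomputable def localFactorTuple {G : Type*} [Group G] [TopologicalSpace G] (UH : Set G)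
    (U : TopologicalSpace.Opens G) (h1 : (1 : G) ∈ U) :
    LocalTransformationTuple G (LocalFactorSpace UH U) where
  U := U
  p := localProj UH U ⟨1, h1⟩
  Ω := univ
  W := {q | q.1 ∈ U ∧ ∃ b : U, localProj UH U b = q.2 ∧ q.1 * (b : G) ∈ U}
  Θ q := if h : ∃ b : U, localProj UH U b = q.2 ∧ q.1 * (b : G) ∈ U then
      localProj UH U ⟨q.1 * (h.choose : G), h.choose_spec.2⟩
    else q.2

/-- A charted space structure on the local factor space (for the quotient topology) is
an *analytic factor structure* if it is real analytic, the canonical projection is a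
`C^ω`-submersion, and the tuple `(G, U, U/~, W, Θ)` is a local Lie group of
`C^ω`-transformations acting transitively on `(U/~, [1])`. -/
structure IsAnalyticFactorStructure {E G : Type*} [NormedAddCommGroup E] [NormedSpace ℝ E]
    [Group G] [TopologicalSpace G] [ChartedSpace E G] (UH : Set G)
    (U : TopologicalSpace.Opens G) (h1 : (1 : G) ∈ U) (m : ℕ)
    (cs : ChartedSpace (EuclideanSpace ℝ (Fin m)) (LocalFactorSpace UH U)) : Prop where
  isManifold : IsManifold (𝓡 m) ω (LocalFactorSpace UH U)
  contMDiff_proj : ContMDiff 𝓘(ℝ, E) (𝓡 m) ω (localProj UH U)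
  submersion_proj : ∀ a : U,
    Function.Surjective (mfderiv 𝓘(ℝ, E) (𝓡 m) (localProj UH U) a)
  isLocalLieGroup : (localFactorTuple UH U h1).IsLocalLieGroup (A := E)
    (B := EuclideanSpace ℝ (Fin m)) ω
  isTransitive : (localFactorTuple UH U h1).IsTransitive

/-!
The heart of the matter is the local structure of a Lie subgroup `ι : H →* G`. Choosing a complement
of the tangent space of `H` in that of `G`, the inverse function theorem gives a transversal `σ`
such that `(k, h) ↦ σ k * ι h` is an analytic local diffeomorphism at the unit
(`IsLieSubgroup.exists_transversal`). In these coordinates a small piece of the subgroup is the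
slice `k = 0`, which yields an admissible triple (`IsTransversal.exists_isAdmissibleTriple`).

Conversely, let `(UH, U, V)` be any admissible triple. In the same coordinates `UH` is, near the
unit, a union of sheets `{k} × H`, with `k` in a set which is locally closed, because `UH` is closed
in `V`, and countable, because `H` is second countable. By the Baire category theorem one of the
sheets is isolated, and the sub-local group property carries this over to the sheet of the unit:
near the unit `UH` is a single sheet (`IsTransversal.exists_nhds_inter_subset`). In particular the
germ of `UH` at the unit does not depend on the triple.

It follows that for `a ∈ U` the map `t ↦ [a * σ t]` is a local parametrization of `U / ~`. Its
inverses are charts for which the projection is an analytic submersion, and such charts are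
automatically compatible (`exists_chartedSpace_of_submersionCharts`,
`exists_submersionChart_of_slice`, `IsAdmissibleTriple.exists_chartedSpace`). Everything else is
formal, because submersions have analytic local sections (`exists_analytic_section`): the partial
action is analytic, the analytic structure is unique
(`exists_diffeomorph_of_submersions`), and two triples whose sets `UH` have the same germ at the
unit give locally equivalent factor spaces (`IsAdmissibleTriple.locallyEquivalent`). The Hausdorff
property comes from the closedness of the relation, which is the closedness of `UH` in `V`.
-/

/-! ### The analytic inverse function theorem on manifolds, and sections of submersions -/

section InverseFunctionTheorem

variable {A B HA HB M N : Type*}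
  [NormedAddCommGroup A] [NormedSpace ℝ A] [NormedAddCommGroup B] [NormedSpace ℝ B]
  [TopologicalSpace HA] [TopologicalSpace HB]
  {I : ModelWithCorners ℝ A HA} {J : ModelWithCorners ℝ B HB}
  [TopologicalSpace M] [ChartedSpace HA M] [TopologicalSpace N] [ChartedSpace HB N]

/-- The inverse function theorem for analytic maps between boundaryless manifolds, with the local
inverse given as a germ at `f x`. -/
theorem exists_analytic_localInverse [I.Boundaryless] [J.Boundaryless]
    [IsManifold I ω M] [IsManifold J ω N] [CompleteSpace A] [CompleteSpace B] {f : M → N} {x : M}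
    (hf : ContMDiffAt I J ω f x) (hb : Function.Bijective (mfderiv I J f x)) :
    ∃ g : N → M, g (f x) = x ∧ ContMDiffAt J I ω g (f x) ∧
      (∀ᶠ y in 𝓝 x, g (f y) = y) ∧ ∀ᶠ z in 𝓝 (f x), f (g z) = z := by
  have hd : MDifferentiableAt I J f x := hf.mdifferentiableAt (by simp)
  obtain ⟨hcont, hF⟩ := contMDiffAt_iff.1 hf
  rw [I.range_eq_univ, contDiffWithinAt_univ] at hF
  set F : A → B := extChartAt J (f x) ∘ f ∘ (extChartAt I x).symm with hFdef
  set a : A := extChartAt I x x with ha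
  let f' : A ≃L[ℝ] B := ContinuousLinearEquiv.ofBijective (mfderiv I J f x)
    (LinearMap.ker_eq_bot.2 hb.1) (LinearMap.range_eq_top.2 hb.2)
  have hF' : HasFDerivAt F (f' : A →L[ℝ] B) a := by
    have := hd.hasMFDerivAt.2
    rw [I.range_eq_univ] at this
    exact HasFDerivWithinAt.hasFDerivAt_of_univ this
  let e := hF.toOpenPartialHomeomorph F hF' (by simp)
  have hae : a ∈ e.source := hF.mem_toOpenPartialHomeomorph_source hF' _
  have hFa : F a = extChartAt J (f x) (f x) := by simp [hFdef, ha]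
  have hes : e.symm (F a) = a := e.left_inv hae
  have hsymm : ContDiffAt ℝ ω e.symm (F a) := by
    refine e.contDiffAt_symm (e.map_source hae) (f₀' := f') ?_ ?_
    · rw [hes]; exact hF'
    · rw [hes]; exact hF
  have hcs : ContinuousAt e.symm (F a) := hsymm.continuousAt
  have hxs : x = (extChartAt I x).symm a := by simp [ha]
  refine ⟨(extChartAt I x).symm ∘ e.symm ∘ extChartAt J (f x), ?_, ?_, ?_, ?_⟩
  · simp only [Function.comp, ← hFa, hes, ← hxs]
  · have h1 : ContMDiffAt J 𝓘(ℝ, B) ω (extChartAt J (f x)) (f x) := contMDiffAt_extChartAt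
    have h2 : ContMDiffAt 𝓘(ℝ, B) 𝓘(ℝ, A) ω e.symm (extChartAt J (f x) (f x)) := by
      rw [← hFa]; exact hsymm.contMDiffAt
    have h3 : ContMDiffAt 𝓘(ℝ, A) I ω (extChartAt I x).symm a :=
      (contMDiffOn_extChartAt_symm x).contMDiffAt (extChartAt_target_mem_nhds x)
    refine ContMDiffAt.comp (f x) (g := (extChartAt I x).symm) ?_ (h2.comp (f x) h1)
    simpa only [Function.comp, ← hFa, hes] using h3
  · have h1 : ∀ᶠ y in 𝓝 x, extChartAt I x y ∈ e.source :=
      (continuousAt_extChartAt x).eventually (e.open_source.mem_nhds hae)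
    filter_upwards [h1, extChartAt_source_mem_nhds (I := I) x] with y hy hyx
    have h2 : extChartAt J (f x) (f y) = e (extChartAt I x y) := by
      change _ = F _
      simp only [hFdef, Function.comp, (extChartAt I x).left_inv hyx]
    simp only [Function.comp, h2, e.left_inv hy, (extChartAt I x).left_inv hyx]
  · have h1 : ∀ᶠ z in 𝓝 (f x), extChartAt J (f x) z ∈ e.target := by
      refine (continuousAt_extChartAt (f x)).eventually (e.open_target.mem_nhds ?_)
      rw [← hFa]; exact e.map_source hae
    have h2 : ContinuousAt (f ∘ (extChartAt I x).symm ∘ e.symm ∘ extChartAt J (f x)) (f x) := by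
      have h3 : ContinuousAt (e.symm ∘ extChartAt J (f x)) (f x) :=
        ContinuousAt.comp (by rw [← hFa]; exact hcs) (continuousAt_extChartAt (f x))
      have h4 : ContinuousAt (f ∘ (extChartAt I x).symm) a :=
        ContinuousAt.comp (by rw [← hxs]; exact hcont) (continuousAt_extChartAt_symm x)
      refine ContinuousAt.comp (g := f ∘ (extChartAt I x).symm) ?_ h3
      simpa only [Function.comp, ← hFa, hes] using h4
    have h5 : ∀ᶠ z in 𝓝 (f x), (f ∘ (extChartAt I x).symm ∘ e.symm ∘ extChartAt J (f x)) z ∈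
        (extChartAt J (f x)).source := by
      refine h2.eventually ?_
      simp only [Function.comp, ← hFa, hes, ← hxs]
      exact extChartAt_source_mem_nhds (I := J) (f x)
    filter_upwards [h1, h5, extChartAt_source_mem_nhds (I := J) (f x)] with z hz hz' hzx
    refine (extChartAt J (f x)).injOn hz' hzx ?_
    exact e.right_inv hz

/-- The parametrized affine slice `t ↦ L t` through `x`, read in the chart at `x`, has derivative
`L` at `0`: the chart at `x` identifies the tangent space at `x` with the model space. -/
theorem hasMFDerivAt_extChartAt_symm_add [I.Boundaryless] [IsManifold I ω M] (x : M)
    (L : B →L[ℝ] A) :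
    HasMFDerivAt 𝓘(ℝ, B) I (fun t : B => (extChartAt I x).symm (extChartAt I x x + L t)) 0
      (L : B →L[ℝ] A) := by
  have h0 : (extChartAt I x).symm (extChartAt I x x + L 0) = x := by simp
  have hcont : ContinuousAt (fun t : B => extChartAt I x x + L t) 0 := by fun_prop
  refine ⟨?_, ?_⟩
  · refine ContinuousAt.comp (g := (extChartAt I x).symm) ?_ hcont
    simpa using continuousAt_extChartAt_symm x
  · have h1 : HasFDerivAt (fun t : B => extChartAt I x x + L t) L 0 :=
      L.hasFDerivAt.const_add _
    have h2 : (fun t : B => extChartAt I x x + L t) =ᶠ[𝓝 0]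
        writtenInExtChartAt 𝓘(ℝ, B) I 0
          (fun t : B => (extChartAt I x).symm (extChartAt I x x + L t)) := by
      have : ∀ᶠ t in 𝓝 (0 : B), extChartAt I x x + L t ∈ (extChartAt I x).target := by
        refine hcont.eventually (p := (· ∈ (extChartAt I x).target)) ?_
        beta_reduce
        rw [map_zero, add_zero]
        exact extChartAt_target_mem_nhds x
      filter_upwards [this] with t ht
      simp only [writtenInExtChartAt, h0, Function.comp, extChartAt_model_space_eq_id,
        PartialEquiv.refl_symm, PartialEquiv.refl_coe, id, (extChartAt I x).right_inv ht]
    exact (h2.hasFDerivAt_iff.1 h1).hasFDerivWithinAt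

theorem contMDiffAt_extChartAt_symm_add [I.Boundaryless] [IsManifold I ω M] (x : M)
    (L : B →L[ℝ] A) :
    ContMDiffAt 𝓘(ℝ, B) I ω (fun t : B => (extChartAt I x).symm (extChartAt I x x + L t)) 0 := by
  have haff : ContMDiffAt 𝓘(ℝ, B) 𝓘(ℝ, A) ω (fun t : B => extChartAt I x x + L t) 0 :=
    (contDiff_const.add L.contDiff).contDiffAt.contMDiffAt
  have hsym : ContMDiffAt 𝓘(ℝ, A) I ω (extChartAt I x).symm (extChartAt I x x + L 0) := by
    rw [map_zero, add_zero]
    exact (contMDiffOn_extChartAt_symm x).contMDiffAt (extChartAt_target_mem_nhds x)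
  exact hsym.comp (0 : B) haff

/-- A map which is a submersion at `x` has an analytic local section through `x`: restrict the map
to the image, in a chart, of a right inverse of the derivative, and invert the restriction. -/
theorem exists_analytic_section [I.Boundaryless] [J.Boundaryless]
    [IsManifold I ω M] [IsManifold J ω N] [CompleteSpace A] [FiniteDimensional ℝ B] {f : M → N}
    {x : M} (hf : ContMDiffAt I J ω f x) (hs : Function.Surjective (mfderiv I J f x)) :
    ∃ s : N → M, s (f x) = x ∧ ContMDiffAt J I ω s (f x) ∧ ∀ᶠ y in 𝓝 (f x), f (s y) = y := by
  have : CompleteSpace B := FiniteDimensional.complete ℝ B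
  let D : A →L[ℝ] B := mfderiv I J f x
  obtain ⟨L, hL⟩ := D.toLinearMap.exists_rightInverse_of_surjective
    (LinearMap.range_eq_top.2 hs)
  let L' : B →L[ℝ] A := LinearMap.toContinuousLinearMap L
  have hDL : D.comp L' = ContinuousLinearMap.id ℝ B :=
    ContinuousLinearMap.ext fun v => LinearMap.congr_fun hL v
  let c : B → M := fun t => (extChartAt I x).symm (extChartAt I x x + L' t)
  have hc0 : c 0 = x := by simp [c]
  have hc : ContMDiffAt 𝓘(ℝ, B) I ω c 0 := contMDiffAt_extChartAt_symm_add x L'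
  have hfc : ContMDiffAt 𝓘(ℝ, B) J ω (f ∘ c) 0 :=
    ContMDiffAt.comp (0 : B) (by rw [hc0]; exact hf) hc
  have hfD : HasMFDerivAt I J f (c 0) D := by
    rw [hc0]; exact (hf.mdifferentiableAt (by simp)).hasMFDerivAt
  have hd : mfderiv 𝓘(ℝ, B) J (f ∘ c) 0 = ContinuousLinearMap.id ℝ B :=
    ((hfD.comp (0 : B) (hasMFDerivAt_extChartAt_symm_add x L')).mfderiv).trans hDL
  obtain ⟨g, hg0, hg, -, hfg⟩ := exists_analytic_localInverse hfc
    (hd ▸ Function.bijective_id : Function.Bijective (mfderiv 𝓘(ℝ, B) J (f ∘ c) 0))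
  have hfc0 : (f ∘ c) 0 = f x := by simp [hc0]
  rw [hfc0] at hg0 hg hfg
  refine ⟨c ∘ g, by simp [hg0, hc0], ?_, hfg⟩
  refine ContMDiffAt.comp (f x) ?_ hg
  rw [hg0]; exact hc

end InverseFunctionTheorem

/-! ### Analytic structures on open quotients of a manifold -/

section QuotientManifold

variable {E B M Q : Type*} [NormedAddCommGroup E] [NormedSpace ℝ E]
  [NormedAddCommGroup B] [NormedSpace ℝ B] [TopologicalSpace M] [ChartedSpace E M]
  [TopologicalSpace Q]

/-- A chart `e` of the base `Q` of `π : M → Q` for which `π` is an analytic submersion: `e ∘ π` is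
analytic, and through every point `x` over the domain of `e` there passes an analytic local lift of
`e.symm`. The base `Q` carries no analytic structure here; any two such charts are compatible. -/
structure IsSubmersionChart (π : M → Q) (e : OpenPartialHomeomorph Q B) : Prop where
  contMDiffAt : ∀ x, π x ∈ e.source → ContMDiffAt 𝓘(ℝ, E) 𝓘(ℝ, B) ω (e ∘ π) x
  exists_lift : ∀ x, π x ∈ e.source → ∃ s : B → M, s (e (π x)) = x ∧
    ContMDiffAt 𝓘(ℝ, B) 𝓘(ℝ, E) ω s (e (π x)) ∧ ∀ᶠ t in 𝓝 (e (π x)), π (s t) = e.symm t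

/-- The submersion charts, as soon as they cover `Q`, form an analytic atlas of `Q` for which `π` is
a submersion. -/
theorem exists_chartedSpace_of_submersionCharts [IsManifold 𝓘(ℝ, E) ω M] {π : M → Q}
    (hsurj : Function.Surjective π) (hcont : Continuous π)
    (h : ∀ q, ∃ e : OpenPartialHomeomorph Q B, IsSubmersionChart (E := E) π e ∧ q ∈ e.source) :
    ∃ _ : ChartedSpace B Q, IsManifold 𝓘(ℝ, B) ω Q ∧ ContMDiff 𝓘(ℝ, E) 𝓘(ℝ, B) ω π ∧
      ∀ x, Function.Surjective (mfderiv 𝓘(ℝ, E) 𝓘(ℝ, B) π x) := by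
  choose c hc hcs using h
  let cs : ChartedSpace B Q :=
    { atlas := {e | IsSubmersionChart (E := E) π e}
      chartAt := c
      mem_chart_source := hcs
      chart_mem_atlas := hc }
  have hman : IsManifold 𝓘(ℝ, B) ω Q := by
    refine isManifold_of_contDiffOn 𝓘(ℝ, B) ω Q fun e e' he he' => ?_
    intro t ht
    simp only [modelWithCornersSelf_coe, modelWithCornersSelf_coe_symm, Set.preimage_id,
      Set.range_id, Set.inter_univ, Function.id_comp, Function.comp_id] at ht ⊢
    have ht' : t ∈ e.target ∧ e.symm t ∈ e'.source := by simpa using ht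
    -- near `t`, the transition map is `(e' ∘ π) ∘ s` for a lift `s` of `e.symm`
    obtain ⟨x, hx⟩ := hsurj (e.symm t)
    have hxe : π x ∈ e.source := by rw [hx]; exact e.map_target ht'.1
    have hxt : e (π x) = t := by rw [hx, e.right_inv ht'.1]
    obtain ⟨s, hs0, hs, hsπ⟩ := he.exists_lift x hxe
    rw [hxt] at hs0 hs hsπ
    have h1 : ContMDiffAt 𝓘(ℝ, E) 𝓘(ℝ, B) ω (e' ∘ π) (s t) := by
      rw [hs0]; exact he'.contMDiffAt x (by rw [hx]; exact ht'.2)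
    have h2 : ContMDiffAt 𝓘(ℝ, B) 𝓘(ℝ, B) ω (e' ∘ e.symm) t := by
      refine (h1.comp t hs).congr_of_eventuallyEq ?_
      filter_upwards [hsπ] with u hu
      simp only [Function.comp, hu]
    exact h2.contDiffAt.contDiffWithinAt
  have hπ : ContMDiff 𝓘(ℝ, E) 𝓘(ℝ, B) ω π := fun x =>
    contMDiffAt_iff_target.2 ⟨hcont.continuousAt, (hc (π x)).contMDiffAt x (hcs (π x))⟩
  -- the lift through `x` is a local section of `π`, which splits the derivative of `π` at `x`
  refine ⟨cs, hman, hπ, fun x => ?_⟩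
  obtain ⟨s, hs0, hs, hsπ⟩ := (hc (π x)).exists_lift x (hcs (π x))
  have hchart : ContMDiffAt 𝓘(ℝ, B) 𝓘(ℝ, B) ω (c (π x)) (π x) :=
    contMDiffAt_extChartAt (I := 𝓘(ℝ, B)) (x := π x)
  have h1 : ContMDiffAt 𝓘(ℝ, B) 𝓘(ℝ, E) ω (s ∘ c (π x)) (π x) := hs.comp (π x) hchart
  have h2 : π ∘ (s ∘ c (π x)) =ᶠ[𝓝 (π x)] id := by
    filter_upwards [((c (π x)).continuousAt (hcs (π x))).eventually hsπ,
      (c (π x)).open_source.mem_nhds (hcs (π x))] with q hq hq'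
    simp only [Function.comp, hq, (c (π x)).left_inv hq', id]
  have h3 : HasMFDerivAt 𝓘(ℝ, E) 𝓘(ℝ, B) π ((s ∘ c (π x)) (π x))
      (mfderiv 𝓘(ℝ, E) 𝓘(ℝ, B) π x : E →L[ℝ] B) := by
    have : (s ∘ c (π x)) (π x) = x := hs0
    rw [this]
    exact ((hπ x).mdifferentiableAt (by simp)).hasMFDerivAt
  have h4 := h3.comp (π x) (h1.mdifferentiableAt (by simp)).hasMFDerivAt
  have h5 := (h4.congr_of_eventuallyEq h2.symm).mfderiv
  rw [mfderiv_id] at h5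
  intro v
  exact ⟨_, (DFunLike.congr_fun h5 v).symm⟩

/-- A slice for `π` at `x`, that is, an analytic map `s` through `x` on which `π` is injective,
together with an analytic map `r` sending `y` near `x` to the parameter of the point of the slice in
the fiber of `y`, yields a submersion chart at `π x`, namely the inverse of `π ∘ s`. The local
analytic maps `τ` along the fibers give the chart property at the points of the fibers which are far
from the slice. -/
theorem exists_submersionChart_of_slice [IsManifold 𝓘(ℝ, E) ω M] {π : M → Q}
    (hcont : Continuous π) (hopen : IsOpenMap π)
    (hτ : ∀ x y, π x = π y → ∃ τ : M → M, τ x = y ∧ ContMDiffAt 𝓘(ℝ, E) 𝓘(ℝ, E) ω τ x ∧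
      ∀ᶠ z in 𝓝 x, π (τ z) = π z)
    (x : M) (r : M → B) (s : B → M)
    (hr : ContMDiffAt 𝓘(ℝ, E) 𝓘(ℝ, B) ω r x) (hs : ContMDiffAt 𝓘(ℝ, B) 𝓘(ℝ, E) ω s (r x))
    (hsx : s (r x) = x) (hπ : ∀ᶠ y in 𝓝 x, π (s (r y)) = π y)
    (hinj : ∃ A ∈ 𝓝 (r x), InjOn (π ∘ s) A) :
    ∃ e : OpenPartialHomeomorph Q B, IsSubmersionChart (E := E) π e ∧ π x ∈ e.source := by
  obtain ⟨A', hA', hinj⟩ := hinj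
  -- a neighborhood of `x` on which `r` is analytic, takes small values and computes `π`
  obtain ⟨D, hDsub, hDo, hxD⟩ : ∃ D ⊆ {y | ContMDiffAt 𝓘(ℝ, E) 𝓘(ℝ, B) ω r y ∧
      π (s (r y)) = π y ∧ r y ∈ A'}, IsOpen D ∧ x ∈ D :=
    mem_nhds_iff.1 (((contMDiffAt_iff_contMDiffAt_nhds (by simp)).1 hr).and
      (hπ.and (hr.continuousAt.eventually hA')))
  obtain ⟨A, hAsub, hAo, hxA⟩ : ∃ A ⊆ {t | ContMDiffAt 𝓘(ℝ, B) 𝓘(ℝ, E) ω s t ∧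
      s t ∈ D ∧ t ∈ A'}, IsOpen A ∧ r x ∈ A :=
    mem_nhds_iff.1 (((contMDiffAt_iff_contMDiffAt_nhds (by simp)).1 hs).and
      ((hs.continuousAt.eventually (by rw [hsx]; exact hDo.mem_nhds hxD)).and hA'))
  have hrs : ∀ t ∈ A, r (s t) = t := fun t ht =>
    hinj (hDsub (hAsub ht).2.1).2.2 (hAsub ht).2.2 (hDsub (hAsub ht).2.1).2.1
  have hrD : ContinuousOn r D := fun y hy => (hDsub hy).1.continuousAt.continuousWithinAt
  have himg : ∀ W ⊆ A, (π ∘ s) '' W = π '' (D ∩ r ⁻¹' W) := by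
    intro W hW
    ext q
    constructor
    · rintro ⟨t, ht, rfl⟩
      exact ⟨s t, ⟨(hAsub (hW ht)).2.1, by rw [mem_preimage, hrs t (hW ht)]; exact ht⟩, rfl⟩
    · rintro ⟨y, ⟨hyD, hyW⟩, rfl⟩
      exact ⟨r y, hyW, (hDsub hyD).2.1⟩
  have himgo : ∀ W ⊆ A, IsOpen W → IsOpen ((π ∘ s) '' W) := fun W hW hWo => by
    rw [himg W hW]
    exact hopen _ (hrD.isOpen_inter_preimage hDo hWo)
  have hinjA : InjOn (π ∘ s) A := hinj.mono fun t ht => (hAsub ht).2.2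
  let P : PartialEquiv B Q := (hinjA.bijOn_image).toPartialEquiv (π ∘ s) A _
  have hPs : ContinuousOn P P.source := fun t ht =>
    (hcont.continuousAt.comp (hAsub ht).1.continuousAt).continuousWithinAt
  have hPo : IsOpenMap (P.source.domRestrict P) := by
    intro W hW
    obtain ⟨W', hW', rfl⟩ := isOpen_induced_iff.1 hW
    have : P.source.domRestrict P '' (Subtype.val ⁻¹' W') = (π ∘ s) '' (A ∩ W') := by
      rw [Set.inter_comm]; exact Set.image_domRestrict _ _ _
    rw [this]
    exact himgo _ inter_subset_left (hAo.inter hW')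
  let e' : OpenPartialHomeomorph B Q := OpenPartialHomeomorph.ofContinuousOpenRestrict P hPs hPo hAo
  have he's : e'.source = A := rfl
  have he'c : ∀ t, e' t = π (s t) := fun t => rfl
  have hsymm : ∀ y ∈ D, r y ∈ A → e'.symm (π y) = r y := by
    intro y hy hyA
    rw [← (hDsub hy).2.1, ← he'c, e'.left_inv hyA]
  refine ⟨e'.symm, ⟨?_, ?_⟩, ?_⟩
  · intro y hy
    obtain ⟨t, ht, hty⟩ : ∃ t ∈ A, π (s t) = π y :=
      ⟨e'.symm (π y), e'.map_target hy, e'.right_inv hy⟩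
    obtain ⟨τ, hτy, hτs, hτπ⟩ := hτ y (s t) hty.symm
    have h1 : ContMDiffAt 𝓘(ℝ, E) 𝓘(ℝ, B) ω (r ∘ τ) y :=
      ContMDiffAt.comp y (by rw [hτy]; exact (hDsub (hAsub ht).2.1).1) hτs
    refine h1.congr_of_eventuallyEq ?_
    have h2 : ∀ᶠ z in 𝓝 y, τ z ∈ D :=
      hτs.continuousAt.eventually (by rw [hτy]; exact hDo.mem_nhds (hAsub ht).2.1)
    have h3 : ∀ᶠ z in 𝓝 y, r (τ z) ∈ A := by
      refine h1.continuousAt.eventually (p := (· ∈ A)) ?_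
      simp only [Function.comp, hτy, hrs t ht]
      exact hAo.mem_nhds ht
    filter_upwards [h2, h3, hτπ] with z hz hz' hz''
    simp only [Function.comp, ← hz'', hsymm _ hz hz']
  · intro y hy
    set t := e'.symm (π y) with htdef
    have ht : t ∈ A := e'.map_target hy
    have hty : π (s t) = π y := e'.right_inv hy
    obtain ⟨τ, hτy, hτs, hτπ⟩ := hτ (s t) y hty
    refine ⟨τ ∘ s, hτy, hτs.comp t (hAsub ht).1, ?_⟩
    exact (hAsub ht).1.continuousAt.eventually hτπ
  · have : e' (r x) ∈ e'.target := e'.map_source hxA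
    rwa [he'c, hsx] at this

end QuotientManifold

/-! ### Transversals to a Lie subgroup -/

section Transversal

variable {E F G H : Type*}
    [NormedAddCommGroup E] [NormedSpace ℝ E]
    [NormedAddCommGroup F] [NormedSpace ℝ F]
    [Group G] [TopologicalSpace G] [ChartedSpace E G]
    [Group H] [TopologicalSpace H] [ChartedSpace F H]

/-- `σ` parametrizes a transversal at the unit to the Lie subgroup `ι : H →* G`: the map
`(k, h) ↦ σ k * ι h` from `B × H` to `G` is an analytic local diffeomorphism at `(0, 1)`, with
local inverse `g`. Both `σ` and `g` are germs, only their values near `0` and `1` are meaningful. -/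
structure IsTransversal {B : Type*} [NormedAddCommGroup B] [NormedSpace ℝ B]
    (ι : H →* G) (σ : B → G) (g : G → B × H) : Prop where
  map_zero : σ 0 = 1
  map_one : g 1 = (0, 1)
  contMDiffAt_slice : ContMDiffAt 𝓘(ℝ, B) 𝓘(ℝ, E) ω σ 0
  contMDiffAt_coord : ContMDiffAt 𝓘(ℝ, E) (𝓘(ℝ, B).prod 𝓘(ℝ, F)) ω g 1
  coord_mul : ∀ᶠ p in 𝓝 ((0 : B), (1 : H)), g (σ p.1 * ι p.2) = p
  mul_coord : ∀ᶠ y in 𝓝 (1 : G), σ (g y).1 * ι (g y).2 = y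

theorem exists_linear_complement [FiniteDimensional ℝ E] (D : F →L[ℝ] E)
    (hD : Function.Injective D) :
    ∃ (m : ℕ) (j : EuclideanSpace ℝ (Fin m) →L[ℝ] E),
      Function.Bijective fun v : EuclideanSpace ℝ (Fin m) × F => j v.1 + D v.2 := by
  obtain ⟨K, hK⟩ := Submodule.exists_isCompl (LinearMap.range D.toLinearMap)
  let φ : EuclideanSpace ℝ (Fin (Module.finrank ℝ K)) ≃L[ℝ] K :=
    ContinuousLinearEquiv.ofFinrankEq (by simp)
  refine ⟨Module.finrank ℝ K, K.subtypeL.comp (φ : _ →L[ℝ] K), ?_, ?_⟩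
  · rintro ⟨v, w⟩ ⟨v', w'⟩ h
    have h1 : (φ (v - v') : E) = D (w' - w) := by
      have h' : (φ v : E) + D w = φ v' + D w' := h
      rw [map_sub, map_sub, Submodule.coe_sub, sub_eq_sub_iff_add_eq_add, h']
      exact add_comm _ _
    have h2 : (φ (v - v') : E) = 0 :=
      Submodule.disjoint_def.1 hK.disjoint _ (h1 ▸ LinearMap.mem_range_self _ _) (φ (v - v')).2
    have h3 : v - v' = 0 := φ.map_eq_zero_iff.1 (Subtype.ext h2)
    have h4 : w' - w = 0 := hD (by rw [← h1, h2, map_zero])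
    rw [sub_eq_zero.1 h3, sub_eq_zero.1 h4]
  · intro e
    obtain ⟨_, ⟨w, rfl⟩, k, hk, rfl⟩ := Submodule.mem_sup.1
      (hK.sup_eq_top ▸ Submodule.mem_top : e ∈ LinearMap.range D.toLinearMap ⊔ K)
    refine ⟨(φ.symm ⟨k, hk⟩, w), ?_⟩
    change (φ (φ.symm ⟨k, hk⟩) : E) + D w = D w + k
    rw [φ.apply_symm_apply, add_comm]

/-- A Lie subgroup has a transversal: an affine slice, in the chart of `G` at the unit, in the
direction of a complement of the tangent space of the subgroup. -/
theorem IsLieSubgroup.exists_transversal [FiniteDimensional ℝ E] [FiniteDimensional ℝ F]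
    [LieGroup 𝓘(ℝ, E) ω G] [LieGroup 𝓘(ℝ, F) ω H] {ι : H →* G}
    (hι : IsLieSubgroup (E := E) (F := F) ι) :
    ∃ (m : ℕ) (σ : EuclideanSpace ℝ (Fin m) → G) (g : G → EuclideanSpace ℝ (Fin m) × H),
      IsTransversal (E := E) (F := F) ι σ g := by
  have : CompleteSpace E := FiniteDimensional.complete ℝ E
  have : CompleteSpace F := FiniteDimensional.complete ℝ F
  let D : F →L[ℝ] E := mfderiv 𝓘(ℝ, F) 𝓘(ℝ, E) ι 1
  obtain ⟨m, j, hj⟩ := exists_linear_complement D (hι.immersion 1)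
  let σ : EuclideanSpace ℝ (Fin m) → G := fun t =>
    (extChartAt 𝓘(ℝ, E) (1 : G)).symm (extChartAt 𝓘(ℝ, E) (1 : G) 1 + j t)
  have hσ0 : σ 0 = 1 := by simp [σ]
  have hσ : ContMDiffAt (𝓡 m) 𝓘(ℝ, E) ω σ 0 := contMDiffAt_extChartAt_symm_add 1 j
  have hσd : HasMFDerivAt (𝓡 m) 𝓘(ℝ, E) σ 0 j := hasMFDerivAt_extChartAt_symm_add 1 j
  let Ψ : EuclideanSpace ℝ (Fin m) × H → G := fun p => σ p.1 * ι p.2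
  have hΨ : ContMDiffAt ((𝓡 m).prod 𝓘(ℝ, F)) 𝓘(ℝ, E) ω Ψ (0, 1) :=
    (ContMDiffAt.comp (0, 1) (g := σ) hσ contMDiffAt_fst).mul
      (ContMDiffAt.comp (0, 1) (hι.contMDiff 1) contMDiffAt_snd)
  have hΨ0 : Ψ (0, 1) = 1 := by simp [Ψ, hσ0]
  have hd : ∀ v : EuclideanSpace ℝ (Fin m) × F,
      mfderiv ((𝓡 m).prod 𝓘(ℝ, F)) 𝓘(ℝ, E) Ψ (0, 1) v = j v.1 + D v.2 := by
    intro v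
    refine (mfderiv_prod_eq_add_apply (hΨ.mdifferentiableAt (by simp))).trans ?_
    have h1 : HasMFDerivAt (𝓡 m) 𝓘(ℝ, E) (fun z => Ψ (z, 1)) 0 j := by
      have : (fun z => Ψ (z, 1)) = σ := by ext z; simp [Ψ]
      rw [this]; exact hσd
    have h2 : HasMFDerivAt 𝓘(ℝ, F) 𝓘(ℝ, E) (fun z => Ψ (0, z)) 1 D := by
      have : (fun z => Ψ (0, z)) = ι := by ext z; simp [Ψ, hσ0]
      rw [this]; exact ((hι.contMDiff 1).mdifferentiableAt (by simp)).hasMFDerivAt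
    exact congrArg₂ (fun a b : E => a + b) (DFunLike.congr_fun h1.mfderiv v.1)
      (DFunLike.congr_fun h2.mfderiv v.2)
  have hbij : Function.Bijective (mfderiv ((𝓡 m).prod 𝓘(ℝ, F)) 𝓘(ℝ, E) Ψ (0, 1)) := by
    have : (fun v => mfderiv ((𝓡 m).prod 𝓘(ℝ, F)) 𝓘(ℝ, E) Ψ (0, 1) v) =
        fun v : EuclideanSpace ℝ (Fin m) × F => j v.1 + D v.2 := funext hd
    exact (congrArg Function.Bijective this).mpr hj
  obtain ⟨g, hg1, hg, hgl, hgr⟩ := exists_analytic_localInverse hΨ hbij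
  rw [hΨ0] at hg1 hg hgr
  exact ⟨m, σ, g, ⟨hσ0, hg1, hσ, hg, hgl, hgr⟩⟩

end Transversal

/-! ### Small connected neighborhoods of the unit -/

section TopologicalGroup

variable {G : Type*} [Group G] [TopologicalSpace G] [IsTopologicalGroup G]

theorem exists_nhds_one_pow_subset (n : ℕ) {V : Set G} (hV : V ∈ 𝓝 (1 : G)) :
    ∃ W ∈ 𝓝 (1 : G), W ^ n ⊆ V := by
  induction n generalizing V with
  | zero =>
    refine ⟨univ, Filter.univ_mem, ?_⟩
    rw [pow_zero]
    exact one_subset.2 (mem_of_mem_nhds hV)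
  | succ n ih =>
    obtain ⟨V', hV'o, hV'1, hV'⟩ := exists_open_nhds_one_mul_subset hV
    obtain ⟨W, hW, hWV⟩ := ih (hV'o.mem_nhds hV'1)
    refine ⟨W ∩ V', Filter.inter_mem hW (hV'o.mem_nhds hV'1), ?_⟩
    rw [pow_succ]
    exact (mul_subset_mul ((pow_left_mono n inter_subset_left).trans hWV)
      inter_subset_right).trans hV'

theorem exists_isConnected_opens_pow_subset [LocallyConnectedSpace G] (n : ℕ) {V : Set G}
    (hV : V ∈ 𝓝 (1 : G)) :
    ∃ U : TopologicalSpace.Opens G, (1 : G) ∈ U ∧ (U : Set G)⁻¹ = U ∧ IsConnected (U : Set G) ∧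
      (U : Set G) ^ n ⊆ V := by
  obtain ⟨W, hW, hWV⟩ := exists_nhds_one_pow_subset n hV
  obtain ⟨O, hOW, hOo, hO1⟩ :=
    mem_nhds_iff.1 (Filter.inter_mem hW (inv_mem_nhds_one G hW))
  set K : Set G := connectedComponentIn O 1
  have hK1 : (1 : G) ∈ K := mem_connectedComponentIn hO1
  have hKc : IsConnected K := isConnected_connectedComponentIn_iff.2 hO1
  have hKo : IsOpen K := hOo.connectedComponentIn
  have hKO : K ⊆ O := connectedComponentIn_subset O 1
  refine ⟨⟨K ∪ K⁻¹, hKo.union hKo.inv⟩, Or.inl hK1, ?_, ?_, ?_⟩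
  · change (K ∪ K⁻¹)⁻¹ = K ∪ K⁻¹
    rw [union_inv, inv_inv, union_comm]
  · refine IsConnected.union ⟨1, hK1, by simpa using hK1⟩ hKc ?_
    rw [← image_inv_eq_inv]
    exact hKc.image _ continuous_inv.continuousOn
  · refine (pow_left_mono n (union_subset ?_ ?_)).trans hWV
    · exact fun x hx => (hOW (hKO hx)).1
    · exact fun x hx => by simpa using (hOW (hKO hx)).2

end TopologicalGroup

/-! ### The equivalence relation of an admissible triple -/

section SubLocalGroup

variable {G H : Type*} [Group G] [TopologicalSpace G] [Group H] [TopologicalSpace H]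
  {ι : H →* G} {UH : Set G} {U V : TopologicalSpace.Opens G}

theorem IsAdmissibleTriple.mul_mem_V (hT : IsAdmissibleTriple ι UH U V) {a b : G} (ha : a ∈ U)
    (hb : b ∈ U) : a * b ∈ V := by
  refine hT.pow_subset ?_
  have h1 : a * b * 1 * 1 * 1 * 1 ∈ (U : Set G) ^ 6 := by
    simp only [pow_succ, pow_zero, one_mul]
    exact mul_mem_mul (mul_mem_mul (mul_mem_mul (mul_mem_mul (mul_mem_mul ha hb)
      hT.one_mem_U) hT.one_mem_U) hT.one_mem_U) hT.one_mem_U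
  simpa using h1

theorem IsAdmissibleTriple.mul_mul_mem_V (hT : IsAdmissibleTriple ι UH U V) {a b c : G}
    (ha : a ∈ U) (hb : b ∈ U) (hc : c ∈ U) : a * b * c ∈ V := by
  refine hT.pow_subset ?_
  have h1 : a * b * c * 1 * 1 * 1 ∈ (U : Set G) ^ 6 := by
    simp only [pow_succ, pow_zero, one_mul]
    exact mul_mem_mul (mul_mem_mul (mul_mem_mul (mul_mem_mul (mul_mem_mul ha hb)
      hc) hT.one_mem_U) hT.one_mem_U) hT.one_mem_U
  simpa using h1

theorem IsAdmissibleTriple.inv_mem (hT : IsAdmissibleTriple ι UH U V) {a : G} (ha : a ∈ U) :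
    a⁻¹ ∈ U := by
  have : a⁻¹ ∈ (U : Set G)⁻¹ := by simpa using ha
  rwa [hT.inv_U] at this

theorem IsAdmissibleTriple.equivalence (hT : IsAdmissibleTriple ι UH U V) :
    Equivalence (localRel UH U) where
  refl a := by
    simpa [localRel] using hT.isSubLocalGroup.one_mem
  symm {a b} h := by
    have h1 := hT.isSubLocalGroup.inv_mem _ h
    rw [mul_inv_rev, inv_inv] at h1
    exact h1 (hT.mul_mem_V (hT.inv_mem b.2) a.2)
  trans {a b c} h h' := by
    have h1 := hT.isSubLocalGroup.mul_mem _ h _ h'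
    rw [show (a : G)⁻¹ * b * ((b : G)⁻¹ * c) = (a : G)⁻¹ * c by group] at h1
    exact h1 (hT.mul_mem_V (hT.inv_mem a.2) c.2)

theorem IsAdmissibleTriple.isClosed_inter (hT : IsAdmissibleTriple ι UH U V) :
    ∃ Z : Set G, IsClosed Z ∧ ∀ x ∈ V, x ∈ Z ↔ x ∈ UH := by
  obtain ⟨Z, hZ, hZU⟩ := isClosed_induced_iff.1 hT.isClosed
  exact ⟨Z, hZ, fun x hx => Set.ext_iff.1 hZU ⟨x, hx⟩⟩

end SubLocalGroup

/-! ### Admissible triples near the unit -/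

section Transversal

variable {E F G H B : Type*}
    [NormedAddCommGroup E] [NormedSpace ℝ E]
    [NormedAddCommGroup F] [NormedSpace ℝ F]
    [Group G] [TopologicalSpace G] [ChartedSpace E G]
    [Group H] [TopologicalSpace H] [ChartedSpace F H]
    [NormedAddCommGroup B] [NormedSpace ℝ B] {ι : H →* G} {σ : B → G} {g : G → B × H}

theorem IsTransversal.eventually_continuousAt_slice [IsManifold 𝓘(ℝ, E) ω G]
    (hσ : IsTransversal (E := E) (F := F) ι σ g) : ∀ᶠ k in 𝓝 (0 : B), ContinuousAt σ k :=
  ((contMDiffAt_iff_contMDiffAt_nhds (by simp)).1 hσ.contMDiffAt_slice).mono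
    fun _ h => h.continuousAt

theorem IsTransversal.eventually_continuousAt_coord [IsManifold 𝓘(ℝ, E) ω G]
    [IsManifold 𝓘(ℝ, F) ω H] (hσ : IsTransversal (E := E) (F := F) ι σ g) :
    ∀ᶠ y in 𝓝 (1 : G), ContinuousAt g y :=
  ((contMDiffAt_iff_contMDiffAt_nhds (by simp)).1 hσ.contMDiffAt_coord).mono
    fun _ h => h.continuousAt

/-- A small piece `V ∩ ι(C₁)` of a Lie subgroup gives an admissible triple, `C₁` being symmetric
with `C₁ * C₁` inside the domain of the coordinates `g`: in these coordinates the piece is the set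
`(g y).1 = 0`, hence closed in `V`, and a product of two elements of the piece still has the
coordinates expected from `H`, so that it comes back to the piece if it lies in `V`. -/
theorem IsTransversal.exists_isAdmissibleTriple [IsManifold 𝓘(ℝ, E) ω G]
    [IsManifold 𝓘(ℝ, F) ω H] [IsTopologicalGroup G] [IsTopologicalGroup H]
    [LocallyConnectedSpace G] (hσ : IsTransversal (E := E) (F := F) ι σ g) (hι : Continuous ι) :
    ∃ (UH : Set G) (U V : TopologicalSpace.Opens G),
      IsAdmissibleTriple ι UH U V ∧ IsConnected (U : Set G) := by
  have hC₀ : ∀ᶠ h in 𝓝 (1 : H), g (ι h) = (0, h) := by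
    have h1 : Filter.Tendsto (fun h : H => ((0 : B), h)) (𝓝 1) (𝓝 (0, 1)) :=
      (Continuous.prodMk_right (0 : B)).tendsto 1
    filter_upwards [h1.eventually hσ.coord_mul] with h hh
    simpa [hσ.map_zero] using hh
  obtain ⟨C, hCo, hC1, hCC⟩ := exists_open_nhds_one_split hC₀
  set C₁ : Set H := C ∩ C⁻¹
  have hC₁ : C₁ ∈ 𝓝 (1 : H) :=
    (hCo.inter hCo.inv).mem_nhds ⟨hC1, by simpa using hC1⟩
  have hgC : ∀ᶠ y in 𝓝 (1 : G), (g y).2 ∈ C₁ := by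
    refine (continuous_snd.continuousAt.comp hσ.contMDiffAt_coord.continuousAt).eventually
      (p := (· ∈ C₁)) ?_
    simpa [hσ.map_one] using hC₁
  have hgcont := hσ.eventually_continuousAt_coord
  obtain ⟨V₀, hV₀, hV₀o, hV₀1⟩ := mem_nhds_iff.1 (hgC.and (hgcont.and hσ.mul_coord))
  let V : TopologicalSpace.Opens G := ⟨V₀ ∩ V₀⁻¹, hV₀o.inter hV₀o.inv⟩
  have hV1 : (1 : G) ∈ V := ⟨hV₀1, by simpa using hV₀1⟩
  have hVi : (V : Set G)⁻¹ = V := by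
    change (V₀ ∩ V₀⁻¹)⁻¹ = V₀ ∩ V₀⁻¹
    rw [inter_inv, inv_inv, inter_comm]
  obtain ⟨U, hU1, hUi, hUc, hUV⟩ :=
    exists_isConnected_opens_pow_subset 6 (V.isOpen.mem_nhds hV1)
  have hCg : ∀ c ∈ C₁, g (ι c) = (0, c) := fun c hc => by
    simpa using hCC c hc.1 1 hC1
  refine ⟨V ∩ ι '' C₁, U, V, ⟨?_, ?_, hU1, hUi, hV1, hVi, ⟨?_, V.isOpen, inter_subset_left, ?_, ?_⟩,
    ?_, hUV⟩, hUc⟩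
  · exact inter_subset_right.trans (image_subset_range _ _)
  · have h1 : ι ⁻¹' V ∈ 𝓝 (1 : H) :=
      hι.continuousAt.preimage_mem_nhds (by simpa using V.isOpen.mem_nhds hV1)
    exact Filter.mem_of_superset (Filter.inter_mem h1 hC₁) fun h hh =>
      ⟨hh.1, mem_image_of_mem _ hh.2⟩
  · exact ⟨hV1, 1, mem_of_mem_nhds hC₁, ι.map_one⟩
  · rintro _ ⟨-, c, hc, rfl⟩ hV
    exact ⟨hV, c⁻¹, ⟨hc.2, by simpa using hc.1⟩, ι.map_inv c⟩
  · rintro _ ⟨-, c, hc, rfl⟩ _ ⟨-, c', hc', rfl⟩ hV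
    have h1 : g (ι (c * c')) = (0, c * c') := hCC c hc.1 c' hc'.1
    rw [← map_mul] at hV ⊢
    have h2 := (hV₀ hV.1).1
    rw [h1] at h2
    exact ⟨hV, c * c', h2, rfl⟩
  · have h1 : ((↑) ⁻¹' ((V : Set G) ∩ ι '' C₁) : Set V) = {v : V | (g v).1 = 0} := by
      ext v
      constructor
      · rintro ⟨-, c, hc, hcv⟩
        change (g v).1 = 0
        rw [← hcv, hCg c hc]
      · intro hv
        refine ⟨v.2, (g v).2, (hV₀ v.2.1).1, ?_⟩
        have h2 := (hV₀ v.2.1).2.2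
        rwa [show (g v).1 = 0 from hv, hσ.map_zero, one_mul] at h2
    rw [h1]
    refine isClosed_eq (continuous_fst.comp ?_) continuous_const
    exact continuous_iff_continuousAt.2 fun v =>
      (hV₀ v.2.1).2.1.comp continuous_subtype_val.continuousAt

/-- A nonempty countable locally closed set in a locally compact Hausdorff space has an isolated
point, by the Baire category theorem. -/
theorem exists_isOpen_inter_eq_singleton {X : Type*} [TopologicalSpace X] [T2Space X]
    [LocallyCompactSpace X] {T : Set X} (hT : IsLocallyClosed T) (hc : T.Countable)
    (hne : T.Nonempty) : ∃ x ∈ T, ∃ O, IsOpen O ∧ O ∩ T = {x} := by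
  have := hT.locallyCompactSpace
  have := hc.to_subtype
  have := hne.to_subtype
  obtain ⟨x, y, hy⟩ := nonempty_interior_of_iUnion_of_closed (f := fun x : T => ({x} : Set T))
    (fun x => isClosed_singleton) (iUnion_of_singleton T)
  obtain rfl : y = x := mem_singleton_iff.1 (interior_subset hy)
  obtain ⟨O, hO, hOx⟩ := isOpen_induced_iff.1 (isOpen_interior (s := ({y} : Set T)))
  refine ⟨y, y.2, O, hO, ?_⟩
  ext z
  constructor
  · rintro ⟨hz, hzT⟩
    have h1 : (⟨z, hzT⟩ : T) ∈ interior {y} := hOx ▸ hz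
    exact congrArg Subtype.val (mem_singleton_iff.1 (interior_subset h1))
  · rintro rfl
    rw [← hOx] at hy
    exact ⟨hy, y.2⟩

/-- Near the unit, the set `UH` of an admissible triple consists of a single sheet of the Lie
subgroup: it is contained in `ι(C)` for any prescribed neighborhood `C` of the unit of `H`. The
sheets near the unit are indexed by a locally closed set of parameters of the transversal, countable
because `H` is second countable. One of them is thus isolated, and multiplication by a point of
that sheet moves it to the sheet of the unit. -/
theorem IsTransversal.exists_nhds_inter_subset [FiniteDimensional ℝ B]
    [IsManifold 𝓘(ℝ, E) ω G] [IsManifold 𝓘(ℝ, F) ω H] [IsTopologicalGroup G]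
    [IsTopologicalGroup H] [SecondCountableTopology H]
    (hσ : IsTransversal (E := E) (F := F) ι σ g) {UH : Set G} {U V : TopologicalSpace.Opens G}
    (hT : IsAdmissibleTriple ι UH U V) {C : Set H} (hC : C ∈ 𝓝 (1 : H)) :
    ∃ N ∈ 𝓝 (1 : G), UH ∩ N ⊆ ι '' C := by
  have hgcont := hσ.eventually_continuousAt_coord
  have hσcont := hσ.eventually_continuousAt_slice
  have hσ0 : ContinuousAt σ 0 := hσ.contMDiffAt_slice.continuousAt
  obtain ⟨A₀, C₀, hA₀o, hA₀0, hC₀o, hC₀1, hAC⟩ := mem_nhds_prod_iff'.1 hσ.coord_mul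
  obtain ⟨Z, hZ, hZV⟩ := hT.isClosed_inter
  obtain ⟨A, hA, hAo, hA0⟩ := mem_nhds_iff.1 (Filter.Eventually.and (hA₀o.mem_nhds hA₀0) (hσcont.and
    (hσ0.eventually (p := fun y => y ∈ V ∧ ContinuousAt g y ∧
        ∀ᶠ z in 𝓝 y, σ (g z).1 * ι (g z).2 = z)
      (by rw [hσ.map_zero]
          exact Filter.Eventually.and (V.isOpen.mem_nhds hT.one_mem_V)
            (hgcont.and (eventually_eventually_nhds.2 hσ.mul_coord))))))
  -- `T` parametrizes the sheets of `UH` near the unit; an open `A`, rather than a compact ball,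
  -- ensures that a point isolated in `T` is isolated among all nearby sheets
  set T : Set B := A ∩ σ ⁻¹' Z with hTdef
  have hTU : ∀ k, k ∈ T ↔ k ∈ A ∧ σ k ∈ UH := fun k =>
    and_congr_right fun hk => hZV _ (hA hk).2.2.1
  have hTc : IsLocallyClosed T := by
    have h1 : ContinuousOn σ A := fun k hk => (hA hk).2.1.continuousWithinAt
    obtain ⟨W, hW, hWT⟩ := continuousOn_iff_isClosed.1 h1 Z hZ
    rw [hTdef, inter_comm, hWT]
    exact hW.isLocallyClosed.inter hAo.isLocallyClosed
  have hg1 : ∀ k ∈ A, ∀ c ∈ C₀, g (σ k * ι c) = (k, c) := fun k hk c hc =>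
    hAC (show (k, c) ∈ A₀ ×ˢ C₀ from ⟨(hA hk).1, hc⟩)
  -- the translates of `C₀` by the points of `H` over the sheets are disjoint and open in `H`
  have hTcount : T.Countable := by
    have h1 : ∀ k : B, ∃ h : H, k ∈ T → ι h = σ k := fun k => by
      by_cases hk : k ∈ T
      · obtain ⟨h, hh⟩ := hT.subset_range ((hTU k).1 hk).2
        exact ⟨h, fun _ => hh⟩
      · exact ⟨1, fun h => absurd h hk⟩
    choose h hh using h1
    refine Set.PairwiseDisjoint.countable_of_isOpen (s := fun k => h k • C₀) ?_
      (fun k _ => hC₀o.smul (h k)) (fun k _ => ⟨h k * 1, smul_mem_smul_set hC₀1⟩)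
    intro k hk k' hk' hkk'
    refine Set.disjoint_left.2 ?_
    rintro _ ⟨c, hc, rfl⟩ ⟨c', hc', heq⟩
    have h2 : σ k' * ι c' = σ k * ι c := by
      rw [← hh k hk, ← hh k' hk', ← map_mul, ← map_mul]
      exact congrArg ι heq
    have h3 := hg1 k' ((hTU k').1 hk').1 c' hc'
    rw [h2, hg1 k ((hTU k).1 hk).1 c hc] at h3
    exact hkk' (congrArg Prod.fst h3)
  have h0T : (0 : B) ∈ T :=
    (hTU 0).2 ⟨hA0, by rw [hσ.map_zero]; exact hT.isSubLocalGroup.one_mem⟩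
  obtain ⟨k₀, hk₀, O, hO, hOT⟩ := exists_isOpen_inter_eq_singleton hTc hTcount ⟨0, h0T⟩
  obtain ⟨hk₀A, hk₀U⟩ := (hTU k₀).1 hk₀
  have hk₀O : k₀ ∈ O := (hOT.symm.subset rfl).1
  have hgk₀ : g (σ k₀) = (k₀, 1) := by simpa using hg1 k₀ hk₀A 1 hC₀1
  -- translation by `σ k₀` carries the unit to the isolated sheet
  have htr : Filter.Tendsto (fun y : G => σ k₀ * y) (𝓝 1) (𝓝 (σ k₀)) := by
    simpa using (continuous_const_mul (σ k₀)).tendsto 1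
  have hgtr : Filter.Tendsto (fun y : G => g (σ k₀ * y)) (𝓝 1) (𝓝 (k₀, 1)) := by
    rw [← hgk₀]; exact (hA hk₀A).2.2.2.1.tendsto.comp htr
  have hCinv : ∀ᶠ c in 𝓝 (1 : H), c ∈ C ∧ ι c⁻¹ ∈ UH :=
    Filter.Eventually.and hC ((inv_mem_nhds_one H hT.preimage_mem_nhds))
  refine ⟨_, (htr.eventually (V.isOpen.mem_nhds (hA hk₀A).2.2.1)).and
    ((htr.eventually (hA hk₀A).2.2.2.2).and
      (hgtr.eventually (Filter.Eventually.prodMk_nhds (px := (· ∈ O ∩ A))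
        ((hO.inter hAo).mem_nhds ⟨hk₀O, hk₀A⟩) hCinv))), ?_⟩
  rintro y ⟨hyU, hyV, hy, ⟨hyO, hyA⟩, hyC, hyi⟩
  have h1 : σ k₀ * y ∈ UH := hT.isSubLocalGroup.mul_mem _ hk₀U _ hyU hyV
  have h2 : σ (g (σ k₀ * y)).1 = σ k₀ * y * ι (g (σ k₀ * y)).2⁻¹ := by
    rw [map_inv, eq_mul_inv_iff_mul_eq]; exact hy
  have h3 : σ (g (σ k₀ * y)).1 ∈ UH := by
    have h4 := (hA hyA).2.2.1
    rw [h2] at h4 ⊢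
    exact hT.isSubLocalGroup.mul_mem _ h1 _ hyi h4
  have h5 : (g (σ k₀ * y)).1 = k₀ := hOT.subset ⟨hyO, (hTU _).2 ⟨hyA, h3⟩⟩
  refine ⟨(g (σ k₀ * y)).2, hyC, ?_⟩
  rw [h5] at hy
  exact mul_left_cancel hy

end Transversal

/-! ### The topology of the local factor space and its partial action -/

section FactorTopology

variable {G H : Type*} [Group G] [TopologicalSpace G] [Group H] [TopologicalSpace H]
  {ι : H →* G} {UH : Set G} {U V : TopologicalSpace.Opens G}

theorem localProj_surjective : Function.Surjective (localProj UH U) := Quot.mk_surjective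

theorem continuous_localProj : Continuous (localProj UH U) := continuous_quot_mk

theorem IsAdmissibleTriple.localProj_eq_iff (hT : IsAdmissibleTriple ι UH U V) {a b : U} :
    localProj UH U a = localProj UH U b ↔ (a : G)⁻¹ * b ∈ UH :=
  Quot.eq.trans hT.equivalence.eqvGen_iff

theorem IsAdmissibleTriple.isOpenMap_localProj [IsTopologicalGroup G]
    (hT : IsAdmissibleTriple ι UH U V) : IsOpenMap (localProj UH U) := by
  intro O hO
  have hO' : IsOpen ((↑) '' O : Set G) := U.isOpen.isOpenMap_subtype_val O hO
  refine (isQuotientMap_quot_mk (r := localRel UH U)).isOpen_preimage.1 (isOpen_iff_mem_nhds.2 ?_)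
  rintro b ⟨a, haO, hab⟩
  have hU := hT.localProj_eq_iff.1 hab
  -- right translation by `(a⁻¹ b)⁻¹` moves `b` to `a ∈ O` and preserves the classes
  have hcont : ContinuousAt (fun c : U => (c : G) * ((a : G)⁻¹ * b)⁻¹) b := by fun_prop
  have h1 : ∀ᶠ c : U in 𝓝 b, (c : G) * ((a : G)⁻¹ * b)⁻¹ ∈ ((↑) '' O : Set G) := by
    refine hcont.eventually (hO'.mem_nhds ?_)
    exact ⟨a, haO, by group⟩
  filter_upwards [h1] with c hc
  obtain ⟨d, hd, hdc⟩ := hc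
  refine ⟨d, hd, hT.localProj_eq_iff.2 ?_⟩
  rw [hdc, show ((c : G) * ((a : G)⁻¹ * b)⁻¹)⁻¹ * c = (a : G)⁻¹ * b by group]
  exact hU

theorem IsAdmissibleTriple.isOpenQuotientMap_localProj [IsTopologicalGroup G]
    (hT : IsAdmissibleTriple ι UH U V) : IsOpenQuotientMap (localProj UH U) :=
  ⟨localProj_surjective, continuous_localProj, hT.isOpenMap_localProj⟩

theorem IsAdmissibleTriple.t2Space [IsTopologicalGroup G]
    (hT : IsAdmissibleTriple ι UH U V) : T2Space (LocalFactorSpace UH U) := by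
  rw [t2Space_iff_of_isOpenQuotientMap hT.isOpenQuotientMap_localProj]
  obtain ⟨Z, hZ, hZV⟩ := hT.isClosed_inter
  have : {q : U × U | localProj UH U q.1 = localProj UH U q.2} =
      (fun q : U × U => (q.1 : G)⁻¹ * q.2) ⁻¹' Z := by
    ext q
    exact hT.localProj_eq_iff.trans (hZV _ (hT.mul_mem_V (hT.inv_mem q.1.2) q.2.2)).symm
  rw [this]
  exact hZ.preimage (by fun_prop)

theorem image_localRel (a : U) :
    ((↑) '' {b : U | localRel UH U a b} : Set G) = ((a : G) • UH) ∩ (U : Set G) := by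
  ext x
  simp only [mem_image, mem_ofPred_eq, localRel, mem_inter_iff, mem_smul_set_iff_inv_smul_mem,
    smul_eq_mul]
  constructor
  · rintro ⟨b, hb, rfl⟩
    exact ⟨hb, b.2⟩
  · rintro ⟨hx, hxU⟩
    exact ⟨⟨x, hxU⟩, hx, rfl⟩

theorem IsAdmissibleTriple.tuple_apply (hT : IsAdmissibleTriple ι UH U V) (a : G) (b : U)
    (hab : a * (b : G) ∈ U) :
    (localFactorTuple UH U hT.one_mem_U).Θ (a, localProj UH U b) =
      localProj UH U ⟨a * (b : G), hab⟩ := by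
  have h : ∃ c : U, localProj UH U c = localProj UH U b ∧ a * (c : G) ∈ U := ⟨b, rfl, hab⟩
  simp only [localFactorTuple]
  rw [dif_pos h]
  refine hT.localProj_eq_iff.2 ?_
  have h1 := hT.localProj_eq_iff.1 h.choose_spec.1
  rwa [show (a * (h.choose : G))⁻¹ * (a * b) = (h.choose : G)⁻¹ * b by group]

theorem IsAdmissibleTriple.isTransitive (hT : IsAdmissibleTriple ι UH U V) :
    (localFactorTuple UH U hT.one_mem_U).IsTransitive := by
  refine Filter.mem_of_superset Filter.univ_mem fun q _ => ?_
  obtain ⟨a, rfl⟩ := localProj_surjective q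
  have h := LocalTransformationTuple.Orbit.base (T := localFactorTuple UH U hT.one_mem_U)
    (a : G) a.2
  have h1 := hT.tuple_apply a ⟨1, hT.one_mem_U⟩ (by simp)
  simp only [mul_one] at h1
  exact h1 ▸ h

theorem IsAdmissibleTriple.isOpen_tuple_W [IsTopologicalGroup G]
    (hT : IsAdmissibleTriple ι UH U V) : IsOpen (localFactorTuple UH U hT.one_mem_U).W := by
  have h1 : (localFactorTuple UH U hT.one_mem_U).W =
      Prod.map id (localProj UH U) '' {p : G × U | p.1 ∈ U ∧ p.1 * (p.2 : G) ∈ U} := by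
    ext ⟨a, q⟩
    constructor
    · rintro ⟨ha, b, hb, hab⟩
      exact ⟨(a, b), ⟨ha, hab⟩, Prod.ext rfl hb⟩
    · rintro ⟨⟨a', b⟩, ⟨ha, hab⟩, h⟩
      obtain ⟨rfl, rfl⟩ := Prod.mk.inj h
      exact ⟨ha, b, rfl, hab⟩
  rw [h1]
  refine (IsOpenMap.id.prodMap hT.isOpenMap_localProj) _ ?_
  exact (U.isOpen.preimage continuous_fst).inter (U.isOpen.preimage (by fun_prop))

/-- The law `Θ(a, Θ(b, [c])) = Θ(a * b, [c])`. The two sides are computed with representatives `d`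
of `[b * c]` and `c'` of `[c]` which depend on the side, and `d⁻¹ * b * c'` lies in `V` as a product
of three elements of `U`. -/
theorem IsAdmissibleTriple.tuple_mul_act (hT : IsAdmissibleTriple ι UH U V) {a b : G}
    (hb : b ∈ U) {x : LocalFactorSpace UH U}
    (h1 : (b, x) ∈ (localFactorTuple UH U hT.one_mem_U).W)
    (h2 : (a * b, x) ∈ (localFactorTuple UH U hT.one_mem_U).W)
    (h3 : (a, (localFactorTuple UH U hT.one_mem_U).Θ (b, x)) ∈
      (localFactorTuple UH U hT.one_mem_U).W) :
    (localFactorTuple UH U hT.one_mem_U).Θ (a, (localFactorTuple UH U hT.one_mem_U).Θ (b, x)) =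
      (localFactorTuple UH U hT.one_mem_U).Θ (a * b, x) := by
  obtain ⟨-, c, rfl, hbc⟩ := h1
  obtain ⟨-, c', hcc', habc'⟩ := h2
  rw [hT.tuple_apply b c hbc] at h3 ⊢
  obtain ⟨-, d, hd, had⟩ := h3
  change localProj UH U c' = localProj UH U c at hcc'
  change localProj UH U d = localProj UH U ⟨b * c, hbc⟩ at hd
  rw [← hd, ← hcc', hT.tuple_apply a d had, hT.tuple_apply (a * b) c' habc', hT.localProj_eq_iff]
  have h4 := hT.isSubLocalGroup.mul_mem _ (hT.localProj_eq_iff.1 hd) _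
    (hT.localProj_eq_iff.1 hcc'.symm)
  have h5 : (d : G)⁻¹ * (b * c) * ((c : G)⁻¹ * c') = (d : G)⁻¹ * b * c' := by group
  change (d : G)⁻¹ * (b * c) * ((c : G)⁻¹ * c') ∈ (V : Set G) → _ at h4
  change (a * (d : G))⁻¹ * (a * b * c') ∈ UH
  rw [show (a * (d : G))⁻¹ * (a * b * c') = (d : G)⁻¹ * (b * c) * ((c : G)⁻¹ * c') by group]
  exact h4 (h5 ▸ hT.mul_mul_mem_V (hT.inv_mem d.2) hb c'.2)

end FactorTopology

/-! ### Corestriction to an open subset -/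

section Corestriction

open Classical in
/-- The map from `G` to the open subset `U` which is the identity on `U` and has the dummy value `p`
outside `U`. -/
noncomputable def TopologicalSpace.Opens.corestrict {G : Type*} [TopologicalSpace G]
    (U : TopologicalSpace.Opens G) (p : U) (x : G) : U :=
  if h : x ∈ U then ⟨x, h⟩ else p

variable {E G : Type*} [NormedAddCommGroup E] [NormedSpace ℝ E]
    [TopologicalSpace G] [ChartedSpace E G] {U : TopologicalSpace.Opens G} {p : U}

theorem TopologicalSpace.Opens.corestrict_of_mem {x : G} (hx : x ∈ U) :
    U.corestrict p x = ⟨x, hx⟩ := dif_pos hx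

theorem TopologicalSpace.Opens.corestrict_coe (x : U) : U.corestrict p x = x :=
  corestrict_of_mem x.2

theorem TopologicalSpace.Opens.contMDiffAt_corestrict {x : G}
    (hx : x ∈ U) :
    ContMDiffAt 𝓘(ℝ, E) 𝓘(ℝ, E) ω (U.corestrict p) x := by
  refine (contMDiffAt_subtype_iff (U := U) (f := U.corestrict p) (x := ⟨x, hx⟩)).1 ?_
  exact contMDiffAt_id.congr_of_eventuallyEq (Filter.Eventually.of_forall corestrict_coe)

end Corestriction

/-! ### Existence of the analytic structure on the local factor space -/

section FactorManifold

variable {E F G H B : Type*}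
    [NormedAddCommGroup E] [NormedSpace ℝ E]
    [NormedAddCommGroup F] [NormedSpace ℝ F]
    [Group G] [TopologicalSpace G] [ChartedSpace E G]
    [Group H] [TopologicalSpace H] [ChartedSpace F H]
    [NormedAddCommGroup B] [NormedSpace ℝ B] {ι : H →* G} {σ : B → G} {g : G → B × H}
    {UH : Set G} {U V : TopologicalSpace.Opens G}

/-- Right translation by `x⁻¹ * y ∈ UH` moves `x` to the equivalent point `y`, and preserves the
classes. -/
theorem IsAdmissibleTriple.exists_translation [LieGroup 𝓘(ℝ, E) ω G]
    (hT : IsAdmissibleTriple ι UH U V) (x y : U) (hxy : localProj UH U x = localProj UH U y) :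
    ∃ τ : U → U, τ x = y ∧ ContMDiffAt 𝓘(ℝ, E) 𝓘(ℝ, E) ω τ x ∧
      ∀ᶠ z in 𝓝 x, localProj UH U (τ z) = localProj UH U z := by
  have hu := hT.localProj_eq_iff.1 hxy
  set u : G := (x : G)⁻¹ * y with hudef
  have hxu : (x : G) * u = y := by simp [hudef]
  have hm : ContMDiffAt 𝓘(ℝ, E) 𝓘(ℝ, E) ω (fun z : U => (z : G) * u) x :=
    ContMDiffAt.comp x (contMDiff_mul_right (a := u)).contMDiffAt
      contMDiff_subtype_val.contMDiffAt
  refine ⟨fun z => U.corestrict y (z * u), ?_, ?_, ?_⟩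
  · simp only [hxu, TopologicalSpace.Opens.corestrict_coe]
  · refine ContMDiffAt.comp x (g := U.corestrict y) ?_ hm
    exact TopologicalSpace.Opens.contMDiffAt_corestrict (by rw [hxu]; exact y.2)
  · have : ∀ᶠ z : U in 𝓝 x, (z : G) * u ∈ U :=
      hm.continuousAt.eventually (U.isOpen.mem_nhds (by beta_reduce; rw [hxu]; exact y.2))
    filter_upwards [this] with z hz
    rw [TopologicalSpace.Opens.corestrict_of_mem hz, eq_comm, hT.localProj_eq_iff]
    simpa using hu

theorem IsAdmissibleTriple.exists_chartedSpace [FiniteDimensional ℝ B]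
    [LieGroup 𝓘(ℝ, E) ω G] [LieGroup 𝓘(ℝ, F) ω H] [SecondCountableTopology H]
    (hT : IsAdmissibleTriple ι UH U V) (hσ : IsTransversal (E := E) (F := F) ι σ g) :
    ∃ _ : ChartedSpace B (LocalFactorSpace UH U), IsManifold 𝓘(ℝ, B) ω (LocalFactorSpace UH U) ∧
      ContMDiff 𝓘(ℝ, E) 𝓘(ℝ, B) ω (localProj UH U) ∧
      ∀ x, Function.Surjective (mfderiv 𝓘(ℝ, E) 𝓘(ℝ, B) (localProj UH U) x) := by
  have : IsTopologicalGroup G := topologicalGroup_of_lieGroup 𝓘(ℝ, E) ω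
  have : IsTopologicalGroup H := topologicalGroup_of_lieGroup 𝓘(ℝ, F) ω
  refine exists_chartedSpace_of_submersionCharts localProj_surjective continuous_localProj
    fun q => ?_
  obtain ⟨a, rfl⟩ := localProj_surjective q
  have ha : Filter.Tendsto (fun y : U => (a : G)⁻¹ * y) (𝓝 a) (𝓝 1) := by
    have : ContinuousAt (fun y : U => (a : G)⁻¹ * y) a := by fun_prop
    simpa [ContinuousAt] using this
  have hσa : ∀ᶠ t in 𝓝 (0 : B), (a : G) * σ t ∈ U := by
    have : ContinuousAt (fun t => (a : G) * σ t) 0 :=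
      continuousAt_const.mul hσ.contMDiffAt_slice.continuousAt
    refine this.eventually (p := (· ∈ U)) (U.isOpen.mem_nhds ?_)
    simp [hσ.map_zero]
  have hr0 : (g ((a : G)⁻¹ * a)).1 = 0 := by simp [hσ.map_one]
  have hga : Filter.Tendsto (fun y : U => g ((a : G)⁻¹ * y)) (𝓝 a) (𝓝 (0, 1)) := by
    rw [← hσ.map_one]
    exact hσ.contMDiffAt_coord.continuousAt.tendsto.comp ha
  refine exists_submersionChart_of_slice continuous_localProj hT.isOpenMap_localProj
    hT.exists_translation a (fun y => (g ((a : G)⁻¹ * y)).1)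
    (fun t => U.corestrict a (a * σ t)) ?_ ?_ ?_ ?_ ?_
  · have h1 : ContMDiffAt 𝓘(ℝ, E) 𝓘(ℝ, E) ω (fun y : U => (a : G)⁻¹ * y) a :=
      ContMDiffAt.comp a (contMDiff_mul_left (a := (a : G)⁻¹)).contMDiffAt
        contMDiff_subtype_val.contMDiffAt
    have h2 : ContMDiffAt 𝓘(ℝ, E) (𝓘(ℝ, B).prod 𝓘(ℝ, F)) ω g ((a : G)⁻¹ * a) := by
      rw [inv_mul_cancel]; exact hσ.contMDiffAt_coord
    exact contMDiffAt_fst.comp a (ContMDiffAt.comp a h2 h1)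
  · rw [hr0]
    refine ContMDiffAt.comp (0 : B) (g := U.corestrict a) ?_
      (contMDiffAt_const.mul hσ.contMDiffAt_slice)
    exact TopologicalSpace.Opens.contMDiffAt_corestrict hσa.self_of_nhds
  · simp only [hr0, hσ.map_zero, mul_one, TopologicalSpace.Opens.corestrict_coe]
  · have h1 : ∀ᶠ p in 𝓝 ((0 : B), (1 : H)), (a : G) * σ p.1 ∈ U ∧ ι p.2 ∈ UH :=
      Filter.Eventually.prodMk_nhds hσa hT.preimage_mem_nhds
    filter_upwards [hga.eventually h1, ha.eventually hσ.mul_coord] with y hy hy'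
    rw [TopologicalSpace.Opens.corestrict_of_mem hy.1, hT.localProj_eq_iff]
    have h2 : ((a : G) * σ (g ((a : G)⁻¹ * y)).1)⁻¹ * y = ι (g ((a : G)⁻¹ * y)).2 := by
      rw [inv_mul_eq_iff_eq_mul, mul_assoc, hy', mul_inv_cancel_left]
    change ((a : G) * σ (g ((a : G)⁻¹ * y)).1)⁻¹ * y ∈ UH
    rw [h2]
    exact hy.2
  · obtain ⟨A, C, hAo, hA0, hCo, hC1, hAC⟩ := mem_nhds_prod_iff'.1 hσ.coord_mul
    obtain ⟨N, hN, hNC⟩ := hσ.exists_nhds_inter_subset hT (hCo.mem_nhds hC1)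
    have h1 : ∀ᶠ p : B × B in 𝓝 (0 : B) ×ˢ 𝓝 (0 : B), (σ p.1)⁻¹ * σ p.2 ∈ N := by
      have hσ0 := hσ.contMDiffAt_slice.continuousAt
      have h2 : ContinuousAt (fun p : B × B => (σ p.1)⁻¹ * σ p.2) (0, 0) :=
        (ContinuousAt.comp (x := ((0 : B), (0 : B))) (f := Prod.fst) (g := σ) hσ0
          continuousAt_fst).inv.mul
          (ContinuousAt.comp (x := ((0 : B), (0 : B))) (f := Prod.snd) (g := σ) hσ0
          continuousAt_snd)
      rw [← nhds_prod_eq]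
      exact h2.eventually (p := (· ∈ N)) (by simpa [hσ.map_zero] using hN)
    obtain ⟨A', hA', hA'N⟩ := Filter.eventually_prod_self_iff
      (r := fun k k' => (σ k)⁻¹ * σ k' ∈ N).1 h1
    refine ⟨A ∩ A' ∩ {t | (a : G) * σ t ∈ U}, ?_, ?_⟩
    · rw [hr0]
      exact Filter.inter_mem (Filter.inter_mem (hAo.mem_nhds hA0) hA') hσa
    · rintro t ⟨⟨htA, htA'⟩, htU⟩ t' ⟨⟨ht'A, ht'A'⟩, ht'U⟩ h
      simp only [Function.comp, TopologicalSpace.Opens.corestrict_of_mem htU,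
        TopologicalSpace.Opens.corestrict_of_mem ht'U, hT.localProj_eq_iff] at h
      rw [show ((a : G) * σ t)⁻¹ * (a * σ t') = (σ t)⁻¹ * σ t' by group] at h
      obtain ⟨c, hc, hcσ⟩ := hNC ⟨h, hA'N t htA' t' ht'A'⟩
      have h2 : g (σ t * ι c) = (t, c) := hAC (show (t, c) ∈ A ×ˢ C from ⟨htA, hc⟩)
      have h3 : g (σ t' * ι 1) = (t', 1) := hAC (show (t', (1 : H)) ∈ A ×ˢ C from ⟨ht'A, hC1⟩)
      rw [hcσ, mul_inv_cancel_left] at h2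
      rw [map_one, mul_one, h2] at h3
      exact congrArg Prod.fst h3

end FactorManifold

/-! ### Maps out of the base of a submersion -/

section SubmersionFactorization

variable {E B B' M Q Q' : Type*} [NormedAddCommGroup E] [NormedSpace ℝ E] [CompleteSpace E]
  [NormedAddCommGroup B] [NormedSpace ℝ B] [FiniteDimensional ℝ B]
  [NormedAddCommGroup B'] [NormedSpace ℝ B']
  [TopologicalSpace M] [ChartedSpace E M] [IsManifold 𝓘(ℝ, E) ω M]
  [TopologicalSpace Q] [ChartedSpace B Q] [IsManifold 𝓘(ℝ, B) ω Q]
  [TopologicalSpace Q'] [ChartedSpace B' Q']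

/-- Analyticity can be tested after composition with a surjective submersion, because such a map
has analytic local sections. -/
theorem contMDiff_of_comp_submersion {π : M → Q} (hπ : ContMDiff 𝓘(ℝ, E) 𝓘(ℝ, B) ω π)
    (hs : ∀ x, Function.Surjective (mfderiv 𝓘(ℝ, E) 𝓘(ℝ, B) π x))
    (hsurj : Function.Surjective π) {f : Q → Q'}
    (hf : ContMDiff 𝓘(ℝ, E) 𝓘(ℝ, B') ω (f ∘ π)) : ContMDiff 𝓘(ℝ, B) 𝓘(ℝ, B') ω f := by
  intro q
  obtain ⟨x, rfl⟩ := hsurj q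
  obtain ⟨s, -, hs, hsπ⟩ := exists_analytic_section (hπ x) (hs x)
  refine ((hf (s (π x))).comp (π x) hs).congr_of_eventuallyEq ?_
  filter_upwards [hsπ] with y hy
  simp only [Function.comp, hy]

/-- Two submersions with the same fibers have diffeomorphic bases. -/
theorem exists_diffeomorph_of_submersions [FiniteDimensional ℝ B'] [IsManifold 𝓘(ℝ, B') ω Q']
    {π : M → Q} {π' : M → Q'} (hπ : ContMDiff 𝓘(ℝ, E) 𝓘(ℝ, B) ω π)
    (hs : ∀ x, Function.Surjective (mfderiv 𝓘(ℝ, E) 𝓘(ℝ, B) π x))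
    (hsurj : Function.Surjective π) (hπ' : ContMDiff 𝓘(ℝ, E) 𝓘(ℝ, B') ω π')
    (hs' : ∀ x, Function.Surjective (mfderiv 𝓘(ℝ, E) 𝓘(ℝ, B') π' x))
    (hsurj' : Function.Surjective π') (φ : Q ≃ Q') (hφ : ∀ x, φ (π x) = π' x) :
    ∃ Φ : Diffeomorph 𝓘(ℝ, B) 𝓘(ℝ, B') Q Q' ω, ∀ q, Φ.toEquiv q = φ q := by
  have hφ' : ∀ x, φ.symm (π' x) = π x := fun x => by rw [← hφ, φ.symm_apply_apply]
  refine ⟨⟨φ, ?_, ?_⟩, fun q => rfl⟩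
  · refine contMDiff_of_comp_submersion hπ hs hsurj ?_
    rwa [show φ ∘ π = π' from funext hφ]
  · refine contMDiff_of_comp_submersion hπ' hs' hsurj' ?_
    rwa [show φ.symm ∘ π' = π from funext hφ']

end SubmersionFactorization

/-! ### The local factor space as a local Lie group of transformations -/

section FactorManifold

variable {E G H : Type*} [NormedAddCommGroup E] [NormedSpace ℝ E] [FiniteDimensional ℝ E]
    [Group G] [TopologicalSpace G] [ChartedSpace E G] [LieGroup 𝓘(ℝ, E) ω G]
    [Group H] [TopologicalSpace H] {ι : H →* G}
    {UH : Set G} {U V : TopologicalSpace.Opens G} {m : ℕ}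

theorem IsAdmissibleTriple.contMDiffOn_tuple
    (hT : IsAdmissibleTriple ι UH U V)
    [ChartedSpace (EuclideanSpace ℝ (Fin m)) (LocalFactorSpace UH U)]
    [IsManifold (𝓡 m) ω (LocalFactorSpace UH U)]
    (hπ : ContMDiff 𝓘(ℝ, E) (𝓡 m) ω (localProj UH U))
    (hs : ∀ x, Function.Surjective (mfderiv 𝓘(ℝ, E) (𝓡 m) (localProj UH U) x)) :
    ContMDiffOn (𝓘(ℝ, E).prod (𝓡 m)) (𝓡 m) ω (localFactorTuple UH U hT.one_mem_U).Θ
      (localFactorTuple UH U hT.one_mem_U).W := by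
  have : CompleteSpace E := FiniteDimensional.complete ℝ E
  rintro ⟨a, q⟩ ⟨-, b, hbq, hab⟩
  change localProj UH U b = q at hbq
  change a * (b : G) ∈ U at hab
  obtain ⟨s, hsb, hsA, hsπ⟩ := exists_analytic_section (hπ b) (hs b)
  rw [hbq] at hsb hsA hsπ
  have h2 : ContMDiffAt (𝓘(ℝ, E).prod (𝓡 m)) 𝓘(ℝ, E) ω
      (fun p : G × LocalFactorSpace UH U => p.1 * (s p.2 : G)) (a, q) :=
    contMDiffAt_fst.mul (contMDiff_subtype_val.contMDiffAt.comp (a, q)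
      (ContMDiffAt.comp (a, q) (g := s) hsA contMDiffAt_snd))
  have h3 : ContMDiffAt 𝓘(ℝ, E) 𝓘(ℝ, E) ω (U.corestrict b) (a * (s q : G)) :=
    TopologicalSpace.Opens.contMDiffAt_corestrict (by rw [hsb]; exact hab)
  have h4 : ContMDiffAt (𝓘(ℝ, E).prod (𝓡 m)) (𝓡 m) ω
      (fun p : G × LocalFactorSpace UH U => localProj UH U (U.corestrict b (p.1 * (s p.2 : G))))
      (a, q) :=
    (hπ _).comp (a, q) (ContMDiffAt.comp (a, q) (g := U.corestrict b) h3 h2)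
  refine (h4.congr_of_eventuallyEq ?_).contMDiffWithinAt
  have h5 : ∀ᶠ p : G × LocalFactorSpace UH U in 𝓝 (a, q), p.1 * (s p.2 : G) ∈ U :=
    h2.continuousAt.eventually (U.isOpen.mem_nhds (by beta_reduce; rw [hsb]; exact hab))
  have h6 : ∀ᶠ p : G × LocalFactorSpace UH U in 𝓝 (a, q), localProj UH U (s p.2) = p.2 :=
    (continuousAt_snd (p := (a, q))).eventually hsπ
  filter_upwards [h5, h6] with p hp hp'
  rw [TopologicalSpace.Opens.corestrict_of_mem hp, ← hT.tuple_apply, hp']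

/-- It is enough that the projection be an analytic submersion: the partial action is then analytic,
as it is read through local sections of the projection. -/
theorem IsAdmissibleTriple.isAnalyticFactorStructure
    (hT : IsAdmissibleTriple ι UH U V)
    (cs : ChartedSpace (EuclideanSpace ℝ (Fin m)) (LocalFactorSpace UH U))
    (hm : IsManifold (𝓡 m) ω (LocalFactorSpace UH U))
    (hπ : ContMDiff 𝓘(ℝ, E) (𝓡 m) ω (localProj UH U))
    (hs : ∀ x, Function.Surjective (mfderiv 𝓘(ℝ, E) (𝓡 m) (localProj UH U) x)) :
    IsAnalyticFactorStructure (E := E) UH U hT.one_mem_U m cs := by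
  have : IsTopologicalGroup G := topologicalGroup_of_lieGroup 𝓘(ℝ, E) ω
  have hΘ := hT.contMDiffOn_tuple hπ hs
  refine ⟨hm, hπ, hs, ⟨⟨U.isOpen, hT.one_mem_U, hT.inv_U, isOpen_univ, mem_univ _,
    hT.isOpen_tuple_W, ?_, ?_, ?_, mapsTo_univ _ _, hΘ.continuousOn, ?_, ?_, ?_⟩, hΘ⟩,
    hT.isTransitive⟩
  · rintro ⟨a, q⟩ ⟨ha, -⟩
    exact ⟨ha, mem_univ _⟩
  · rintro ⟨a, q⟩ ⟨ha, hq⟩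
    obtain rfl : q = _ := hq
    exact ⟨ha, ⟨1, hT.one_mem_U⟩, rfl, by rw [mul_one]; exact ha⟩
  · rintro ⟨a, q⟩ ⟨ha, -⟩
    obtain rfl : a = 1 := ha
    obtain ⟨b, rfl⟩ := localProj_surjective q
    exact ⟨hT.one_mem_U, b, rfl, by simp⟩
  · exact fun a _ b hb x _ h1 h2 h3 => hT.tuple_mul_act hb h1 h2 h3
  · intro a _
    exact hΘ.comp (contMDiffOn_const.prodMk contMDiffOn_id) fun x hx => hx
  · intro q _
    obtain ⟨b, rfl⟩ := localProj_surjective q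
    rw [hT.tuple_apply 1 b (by simp)]
    simp

end FactorManifold

/-! ### Comparison of two admissible triples -/

section LocalEquivalence

variable {E G H : Type*} [NormedAddCommGroup E] [NormedSpace ℝ E]
    [Group G] [TopologicalSpace G] [ChartedSpace E G]
    [Group H] [TopologicalSpace H] {ι : H →* G}
    {UH UH' : Set G} {U V U' V' : TopologicalSpace.Opens G} {m m' : ℕ} {W : Set G}

open Classical in
/-- The map `[a] ↦ [a]'`, for `a ∈ W`, from the local factor space of `(UH, U)` to that of
`(UH', U')`. The representative in `W` is picked by choice, and the map has the dummy value `[p]'`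
on the classes that do not meet `W`. -/
noncomputable def localFactorTransition (UH : Set G) (U : TopologicalSpace.Opens G) (UH' : Set G)
    (U' : TopologicalSpace.Opens G) (p : U') (W : Set G) (q : LocalFactorSpace UH U) :
    LocalFactorSpace UH' U' :=
  if h : ∃ a : U, (a : G) ∈ W ∧ localProj UH U a = q then
    localProj UH' U' (U'.corestrict p h.choose) else localProj UH' U' p

theorem IsAdmissibleTriple.localFactorTransition_apply (hT : IsAdmissibleTriple ι UH U V)
    (hT' : IsAdmissibleTriple ι UH' U' V') (hWU' : W ⊆ U')
    (hW : ∀ a ∈ W, ∀ b ∈ W, a⁻¹ * b ∈ UH → a⁻¹ * b ∈ UH') (p : U') (a : U) (ha : (a : G) ∈ W) :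
    localFactorTransition UH U UH' U' p W (localProj UH U a) =
      localProj UH' U' ⟨a, hWU' ha⟩ := by
  have h : ∃ b : U, (b : G) ∈ W ∧ localProj UH U b = localProj UH U a := ⟨a, ha, rfl⟩
  rw [localFactorTransition, dif_pos h,
    TopologicalSpace.Opens.corestrict_of_mem (hWU' h.choose_spec.1), hT'.localProj_eq_iff]
  exact hW _ h.choose_spec.1 _ ha (hT.localProj_eq_iff.1 h.choose_spec.2)

theorem IsAdmissibleTriple.contMDiffOn_localFactorTransition [FiniteDimensional ℝ E]
    [LieGroup 𝓘(ℝ, E) ω G]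
    [ChartedSpace (EuclideanSpace ℝ (Fin m)) (LocalFactorSpace UH U)]
    [IsManifold (𝓡 m) ω (LocalFactorSpace UH U)]
    [ChartedSpace (EuclideanSpace ℝ (Fin m')) (LocalFactorSpace UH' U')]
    (hπ : ContMDiff 𝓘(ℝ, E) (𝓡 m) ω (localProj UH U))
    (hs : ∀ x, Function.Surjective (mfderiv 𝓘(ℝ, E) (𝓡 m) (localProj UH U) x))
    (hπ' : ContMDiff 𝓘(ℝ, E) (𝓡 m') ω (localProj UH' U'))
    (hT : IsAdmissibleTriple ι UH U V)
    (hT' : IsAdmissibleTriple ι UH' U' V') (hWo : IsOpen W) (hWU' : W ⊆ U')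
    (hW : ∀ a ∈ W, ∀ b ∈ W, a⁻¹ * b ∈ UH → a⁻¹ * b ∈ UH') (p : U') :
    ContMDiffOn (𝓡 m) (𝓡 m') ω (localFactorTransition UH U UH' U' p W)
      (localProj UH U '' ((↑) ⁻¹' W)) := by
  have : CompleteSpace E := FiniteDimensional.complete ℝ E
  rintro _ ⟨a, ha, rfl⟩
  obtain ⟨s, hsa, hsA, hsπ⟩ := exists_analytic_section (hπ a) (hs a)
  have h1 : ContMDiffAt (𝓡 m) 𝓘(ℝ, E) ω (fun q => (s q : G)) (localProj UH U a) :=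
    contMDiff_subtype_val.contMDiffAt.comp _ hsA
  have hsW : ∀ᶠ q in 𝓝 (localProj UH U a), (s q : G) ∈ W :=
    h1.continuousAt.eventually (hWo.mem_nhds (by beta_reduce; rw [hsa]; exact ha))
  have h2 : ContMDiffAt 𝓘(ℝ, E) 𝓘(ℝ, E) ω (U'.corestrict p) (s (localProj UH U a) : G) :=
    TopologicalSpace.Opens.contMDiffAt_corestrict (hWU' hsW.self_of_nhds)
  have h3 : ContMDiffAt (𝓡 m) (𝓡 m') ω (fun q => localProj UH' U' (U'.corestrict p (s q)))
      (localProj UH U a) :=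
    (hπ' _).comp _ (ContMDiffAt.comp _ (g := U'.corestrict p) h2 h1)
  refine (h3.congr_of_eventuallyEq ?_).contMDiffWithinAt
  filter_upwards [hsW, hsπ] with q hq hq'
  rw [TopologicalSpace.Opens.corestrict_of_mem (hWU' hq),
    ← hT.localFactorTransition_apply hT' hWU' hW p _ hq, hq']

/-- If the sets `UH` and `UH'` have the same germ at the unit, the two local factor spaces are
equivalent through the identity of `G` and the map `[a] ↦ [a]'` for `a` near the unit. -/
theorem IsAdmissibleTriple.locallyEquivalent [FiniteDimensional ℝ E]
    [LieGroup 𝓘(ℝ, E) ω G] (hT : IsAdmissibleTriple ι UH U V)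
    (hT' : IsAdmissibleTriple ι UH' U' V')
    (cs : ChartedSpace (EuclideanSpace ℝ (Fin m)) (LocalFactorSpace UH U))
    (cs' : ChartedSpace (EuclideanSpace ℝ (Fin m')) (LocalFactorSpace UH' U'))
    (h : IsAnalyticFactorStructure (E := E) UH U hT.one_mem_U m cs)
    (h' : IsAnalyticFactorStructure (E := E) UH' U' hT'.one_mem_U m' cs')
    (hgerm : ∀ᶠ x in 𝓝 (1 : G), x ∈ UH ↔ x ∈ UH') :
    LocallyEquivalent (B₁ := EuclideanSpace ℝ (Fin m)) (B₂ := EuclideanSpace ℝ (Fin m')) ω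
      (localFactorTuple UH U hT.one_mem_U) (localFactorTuple UH' U' hT'.one_mem_U) := by
  have : IsTopologicalGroup G := topologicalGroup_of_lieGroup 𝓘(ℝ, E) ω
  have := h.isManifold
  have := h'.isManifold
  -- on `W`, the two relations agree
  obtain ⟨N, hN, hNrel⟩ : ∃ N ∈ 𝓝 (1 : G), ∀ a ∈ N, ∀ b ∈ N,
      (a⁻¹ * b ∈ UH ↔ a⁻¹ * b ∈ UH') := by
    refine (Filter.eventually_prod_self_iff
      (r := fun a b : G => a⁻¹ * b ∈ UH ↔ a⁻¹ * b ∈ UH')).1 ?_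
    have h1 : ContinuousAt (fun p : G × G => p.1⁻¹ * p.2) (1, 1) := by fun_prop
    rw [← nhds_prod_eq]
    exact h1.eventually (by simpa using hgerm)
  obtain ⟨W, hWsub, hWo, hW1⟩ := mem_nhds_iff.1 (Filter.inter_mem hN
    (Filter.inter_mem (U.isOpen.mem_nhds hT.one_mem_U) (U'.isOpen.mem_nhds hT'.one_mem_U)))
  have hWU : W ⊆ U := fun x hx => (hWsub hx).2.1
  have hWU' : W ⊆ U' := fun x hx => (hWsub hx).2.2
  have hW : ∀ a ∈ W, ∀ b ∈ W, (a⁻¹ * b ∈ UH ↔ a⁻¹ * b ∈ UH') := fun a ha b hb =>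
    hNrel a (hWsub ha).1 b (hWsub hb).1
  -- products of an element of `N` and an element of `W'` stay in `W`
  obtain ⟨W', hW'o, hW'1, hW'W⟩ := exists_open_nhds_one_split (hWo.mem_nhds hW1)
  have hW'sub : W' ⊆ W := fun x hx => by simpa using hW'W x hx 1 hW'1
  let f := localFactorTransition UH U UH' U' ⟨1, hT'.one_mem_U⟩ W
  have hf : ∀ (a : U) (ha : (a : G) ∈ W), f (localProj UH U a) = localProj UH' U' ⟨a, hWU' ha⟩ :=
    hT.localFactorTransition_apply hT' hWU' (fun a ha b hb => (hW a ha b hb).1) _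
  let f' := localFactorTransition UH' U' UH U ⟨1, hT.one_mem_U⟩ W
  have hf' : ∀ (a : U') (ha : (a : G) ∈ W), f' (localProj UH' U' a) = localProj UH U ⟨a, hWU ha⟩ :=
    hT'.localFactorTransition_apply hT hWU (fun a ha b hb => (hW a ha b hb).2) _
  have himg : f '' (localProj UH U '' ((↑) ⁻¹' W)) = localProj UH' U' '' ((↑) ⁻¹' W) := by
    ext q
    constructor
    · rintro ⟨_, ⟨a, ha, rfl⟩, rfl⟩
      rw [hf a ha]
      exact ⟨_, ha, rfl⟩
    · rintro ⟨a, ha, rfl⟩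
      exact ⟨_, ⟨⟨a, hWU ha⟩, ha, rfl⟩, hf ⟨a, hWU ha⟩ ha⟩
  have hNU : W' ∩ W'⁻¹ ⊆ W := fun x hx => hW'sub hx.1
  have hNW : ∀ a ∈ W' ∩ W'⁻¹, ∀ b ∈ W', a * b ∈ W := fun a ha b hb => hW'W a ha.1 b hb
  have hid : IsLocalGroupHom (W' ∩ W'⁻¹) (id : G → G) :=
    ⟨hW'o.inter hW'o.inv, ⟨hW'1, by simpa using hW'1⟩, by rw [inter_inv, inv_inv, inter_comm],
      continuousOn_id, rfl, fun _ _ => rfl, fun _ _ _ _ _ => rfl⟩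
  refine ⟨W' ∩ W'⁻¹, id, localProj UH U '' (Subtype.val ⁻¹' W'), localProj UH U '' ((↑) ⁻¹' W), f,
    hNU.trans hWU, ⟨hid, W' ∩ W'⁻¹, id, hid, Filter.Eventually.of_forall fun _ => rfl,
      Filter.Eventually.of_forall fun _ => rfl⟩, fun x hx => hWU' (hNU hx),
    hT.isOpenMap_localProj _ (hW'o.preimage continuous_subtype_val), ⟨⟨1, hT.one_mem_U⟩, hW'1, rfl⟩,
    image_mono (preimage_mono hW'sub), subset_univ _, ⟨?_, ?_, ?_, f', ?_, ?_⟩,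
    mapsTo_univ _ _, hf ⟨1, hT.one_mem_U⟩ hW1, ?_, ?_, ?_, ?_⟩
  · exact hT.isOpenMap_localProj _ (hWo.preimage continuous_subtype_val)
  · rw [himg]
    exact hT'.isOpenMap_localProj _ (hWo.preimage continuous_subtype_val)
  · exact IsAdmissibleTriple.contMDiffOn_localFactorTransition h.contMDiff_proj h.submersion_proj
      h'.contMDiff_proj hT hT' hWo hWU' (fun a ha b hb => (hW a ha b hb).1) _
  · rw [himg]
    exact IsAdmissibleTriple.contMDiffOn_localFactorTransition h'.contMDiff_proj h'.submersion_proj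
      h.contMDiff_proj hT' hT hWo hWU (fun a ha b hb => (hW a ha b hb).2) _
  · rintro _ ⟨a, ha, rfl⟩
    rw [hf a ha, hf' ⟨a, hWU' ha⟩ ha]
  · rintro ⟨a, _⟩ ⟨ha, b, hb, rfl⟩
    exact ⟨hWU (hNU ha), b, rfl, hWU (hNW a ha b hb)⟩
  · rintro ⟨a, _⟩ ⟨ha, b, hb, rfl⟩
    rw [hT.tuple_apply a b (hWU (hNW a ha b hb))]
    exact ⟨_, hNW a ha b hb, rfl⟩
  · rintro ⟨a, _⟩ ⟨⟨a', ha, rfl⟩, _, ⟨b, hb, rfl⟩, hq⟩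
    refine ⟨hWU' (hNU ha), ⟨b, hWU' (hW'sub hb)⟩, ?_, hWU' (hNW a' ha b hb)⟩
    exact (hf b (hW'sub hb)).symm.trans hq
  · rintro a ha _ ⟨b, hb, rfl⟩
    rw [hT.tuple_apply a b (hWU (hNW a ha b hb)), hf _ (hNW a ha b hb), hf b (hW'sub hb)]
    exact (hT'.tuple_apply a ⟨b, hWU' (hW'sub hb)⟩ (hWU' (hNW a ha b hb))).symm

end LocalEquivalence

theorem proposition5p1 {E F G H : Type*}
    [NormedAddCommGroup E] [NormedSpace ℝ E] [FiniteDimensional ℝ E]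
    [NormedAddCommGroup F] [NormedSpace ℝ F] [FiniteDimensional ℝ F]
    [Group G] [TopologicalSpace G] [T2Space G] [SecondCountableTopology G]
    [ChartedSpace E G] [LieGroup 𝓘(ℝ, E) ω G]
    [Group H] [TopologicalSpace H] [SecondCountableTopology H]
    [ChartedSpace F H] [LieGroup 𝓘(ℝ, F) ω H]
    (ι : H →* G) (hι : IsLieSubgroup (E := E) (F := F) ι) :
    -- (a) admissible triples exist (and `U` can be chosen connected)
    (∃ (UH : Set G) (U V : TopologicalSpace.Opens G),
      IsAdmissibleTriple ι UH U V ∧ IsConnected (U : Set G)) ∧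
    -- (b) for every admissible triple, `~` is an equivalence relation, with classes `(a UH) ∩ U`
    (∀ (UH : Set G) (U V : TopologicalSpace.Opens G), IsAdmissibleTriple ι UH U V →
      Equivalence (localRel UH U) ∧
      ∀ a : U, ((↑) '' {b : U | localRel UH U a b} : Set G) = ((a : G) • UH) ∩ (U : Set G)) ∧
    -- (c) the local factor space is a manifold with an essentially unique analytic structure
    -- making the projection a submersion and `(G, U, U/~, W, Θ)` a transitive local Lie group
    (∀ (UH : Set G) (U V : TopologicalSpace.Opens G) (hT : IsAdmissibleTriple ι UH U V),
      T2Space (LocalFactorSpace UH U) ∧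
      SecondCountableTopology (LocalFactorSpace UH U) ∧
      (IsConnected (U : Set G) → ConnectedSpace (LocalFactorSpace UH U)) ∧
      -- `Θ` is well defined by the formula `Θ(a, [b]) = [a * b]`
      (∀ (a : G) (b : U) (_ : a ∈ U) (hab : a * (b : G) ∈ U),
        (localFactorTuple UH U hT.one_mem_U).Θ (a, localProj UH U b)
          = localProj UH U ⟨a * (b : G), hab⟩) ∧
      (∃ (m : ℕ) (cs : ChartedSpace (EuclideanSpace ℝ (Fin m)) (LocalFactorSpace UH U)),
        IsAnalyticFactorStructure (E := E) UH U hT.one_mem_U m cs) ∧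
      (∀ (m m' : ℕ)
        (cs : ChartedSpace (EuclideanSpace ℝ (Fin m)) (LocalFactorSpace UH U))
        (cs' : ChartedSpace (EuclideanSpace ℝ (Fin m')) (LocalFactorSpace UH U)),
        IsAnalyticFactorStructure (E := E) UH U hT.one_mem_U m cs →
        IsAnalyticFactorStructure (E := E) UH U hT.one_mem_U m' cs' →
        ∃ Φ : @Diffeomorph ℝ _ (EuclideanSpace ℝ (Fin m)) _ _ (EuclideanSpace ℝ (Fin m')) _ _
            (EuclideanSpace ℝ (Fin m)) _ (EuclideanSpace ℝ (Fin m')) _ (𝓡 m) (𝓡 m')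
            (LocalFactorSpace UH U) _ cs (LocalFactorSpace UH U) _ cs' ω,
          ∀ x, Φ.toEquiv x = x)) ∧
    -- (d) different admissible triples give locally `C^ω`-equivalent local Lie groups
    (∀ (UH UH' : Set G) (U V U' V' : TopologicalSpace.Opens G)
      (hT : IsAdmissibleTriple ι UH U V) (hT' : IsAdmissibleTriple ι UH' U' V')
      (m m' : ℕ)
      (cs : ChartedSpace (EuclideanSpace ℝ (Fin m)) (LocalFactorSpace UH U))
      (cs' : ChartedSpace (EuclideanSpace ℝ (Fin m')) (LocalFactorSpace UH' U')),
      IsAnalyticFactorStructure (E := E) UH U hT.one_mem_U m cs →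
      IsAnalyticFactorStructure (E := E) UH' U' hT'.one_mem_U m' cs' →
      LocallyEquivalent (B₁ := EuclideanSpace ℝ (Fin m)) (B₂ := EuclideanSpace ℝ (Fin m')) ω
        (localFactorTuple UH U hT.one_mem_U) (localFactorTuple UH' U' hT'.one_mem_U)) := by
  have : IsTopologicalGroup G := topologicalGroup_of_lieGroup 𝓘(ℝ, E) ω
  have : IsTopologicalGroup H := topologicalGroup_of_lieGroup 𝓘(ℝ, F) ω
  have : CompleteSpace E := FiniteDimensional.complete ℝ E
  have : LocallyConnectedSpace G := ChartedSpace.locallyConnectedSpace E G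
  obtain ⟨m₀, σ, g, hσ⟩ := hι.exists_transversal
  refine ⟨hσ.exists_isAdmissibleTriple hι.contMDiff.continuous,
    fun UH U V hT => ⟨hT.equivalence, image_localRel⟩,
    fun UH U V hT => ⟨hT.t2Space, ?_, ?_, fun a b _ hab => hT.tuple_apply a b hab, ?_, ?_⟩, ?_⟩
  · exact hT.isOpenQuotientMap_localProj.isQuotientMap.secondCountableTopology
      hT.isOpenMap_localProj
  · intro hU
    have := isConnected_iff_connectedSpace.1 hU
    exact localProj_surjective.connectedSpace continuous_localProj
  · obtain ⟨cs, hm, hπ, hs⟩ := hT.exists_chartedSpace hσ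
    exact ⟨m₀, cs, hT.isAnalyticFactorStructure cs hm hπ hs⟩
  · intro m m' cs cs' h h'
    exact @exists_diffeomorph_of_submersions E (EuclideanSpace ℝ (Fin m))
      (EuclideanSpace ℝ (Fin m')) U (LocalFactorSpace UH U) (LocalFactorSpace UH U) _ _ _ _ _ _ _ _
      _ _ _ _ cs h.isManifold _ cs' _ h'.isManifold _ _ h.contMDiff_proj h.submersion_proj
      localProj_surjective h'.contMDiff_proj h'.submersion_proj localProj_surjective
      (Equiv.refl _) fun _ => rfl
  · intro UH UH' U V U' V' hT hT' m m' cs cs' h h'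
    obtain ⟨N, hN, hNU⟩ := hσ.exists_nhds_inter_subset hT hT'.preimage_mem_nhds
    obtain ⟨N', hN', hNU'⟩ := hσ.exists_nhds_inter_subset hT' hT.preimage_mem_nhds
    refine hT.locallyEquivalent hT' cs cs' h h' ?_
    filter_upwards [hN, hN'] with x hx hx'
    constructor
    · intro hxU
      obtain ⟨c, hc, rfl⟩ := hNU ⟨hxU, hx⟩
      exact hc
    · intro hxU
      obtain ⟨c, hc, rfl⟩ := hNU' ⟨hxU, hx'⟩
      exact hc
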